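/- For a finite simple graph $G$ on $n$ vertices, let $$s(G)=\sum_{A\subseteq V(G)}\frac{q(G[A])-1}{\binom{n}{|A|}}$$ be its separation index, where $q(G[A])$ is the number of connected components of the subgraph induced by $A$ (so $q=0$ for $A=\emptyset$). For a finite abstract simplicial complex $X$, let $s(X)$ be the separation index of its $1$-skeleton. A triangulated $2$-sphere is a finite abstract simplicial complex whose geometric carrier is homeomorphic to $S^2$; it is called flag if it has no induced $3$-cycle, i.e. no three vertices that span three edges but not a triangle. Let $n\neq 5$. Then every triangulated $2$-sphere whose separation index is minimum amongst all $n$-vertex triangulated $2$-spheres is flag. Moreover, if $n\geq 4$, then such a minimizer exists; in particular the minimum is attained by an $n$-vertex flag $2$-sphere. (For $n<4$ there are no $n$-vertex triangulated $2$-spheres.) -/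

import Mathlib

/-!
Finite abstract simplicial complexes with vertex set `V` are terms of Mathlib's
`AbstractSimplicialComplex V` (every element of `V` is a vertex), with `V` a finite type.
-/

/-- The separation index of a finite graph `G` on `n` vertices:
`s(G) = ∑_{A ⊆ V(G)} (q(G[A]) - 1) / (n choose |A|)`, where `q` is the number of connected
components and `G[A]` the subgraph induced by `A`. The empty set contributes
`(0 - 1) / 1 = -1`. -/
noncomputable def SimpleGraph.separationIndex {V : Type*} [Fintype V] (G : SimpleGraph V) : ℚ :=
  ∑ A : Finset V,
    ((Nat.card (G.induce (A : Set V)).ConnectedComponent : ℚ) - 1) /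
      ((Fintype.card V).choose A.card : ℚ)

namespace AbstractSimplicialComplex

/-- The `1`-skeleton of a simplicial complex, as a graph. -/
def oneSkeleton {V : Type*} [DecidableEq V] (X : AbstractSimplicialComplex V) :
    SimpleGraph V where
  Adj u v := u ≠ v ∧ ({u, v} : Finset V) ∈ X.faces
  symm := ⟨fun u v h => ⟨h.1.symm, by rw [Finset.pair_comm]; exact h.2⟩⟩
  loopless := ⟨fun _ h => h.1 rfl⟩

/-- The geometric carrier of a finite simplicial complex, in barycentric coordinates: the union
of the closed faces of the standard simplex in `ℝ^V` that are spanned by the faces of `X`, with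
the subspace topology. -/
def carrier {V : Type*} [Fintype V] (X : AbstractSimplicialComplex V) : Set (V → ℝ) :=
  {x | x ∈ stdSimplex ℝ V ∧ ∃ σ ∈ X.faces, ∀ v, v ∉ σ → x v = 0}

/-- `X` is a triangulated `2`-sphere: its geometric carrier is homeomorphic to `S²`. -/
def IsTriangulatedTwoSphere {V : Type*} [Fintype V] (X : AbstractSimplicialComplex V) : Prop :=
  Nonempty (X.carrier ≃ₜ Metric.sphere (0 : EuclideanSpace ℝ (Fin 3)) 1)

/-- The separation index of a simplicial complex is that of its `1`-skeleton. -/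
noncomputable def separationIndex {V : Type*} [Fintype V] [DecidableEq V]
    (X : AbstractSimplicialComplex V) : ℚ :=
  X.oneSkeleton.separationIndex

/-- Three vertices span an induced `3`-cycle of `X`: they span three edges but no triangle. -/
def IsInducedThreeCycle {V : Type*} [DecidableEq V] (X : AbstractSimplicialComplex V)
    (u v w : V) : Prop :=
  X.oneSkeleton.Adj u v ∧ X.oneSkeleton.Adj v w ∧ X.oneSkeleton.Adj u w ∧
    ({u, v, w} : Finset V) ∉ X.faces

/-- `X` is a flag `2`-sphere: a triangulated `2`-sphere without induced `3`-cycles. -/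
def IsFlagTwoSphere {V : Type*} [Fintype V] [DecidableEq V]
    (X : AbstractSimplicialComplex V) : Prop :=
  X.IsTriangulatedTwoSphere ∧ ∀ u v w : V, ¬ X.IsInducedThreeCycle u v w

/-- `X` is a triangulated `2`-sphere of minimum separation index amongst all triangulated
`2`-spheres with the same number of vertices (which, up to relabelling, have the same vertex
set). -/
def IsMinimumTwoSphere {V : Type*} [Fintype V] [DecidableEq V]
    (X : AbstractSimplicialComplex V) : Prop :=
  X.IsTriangulatedTwoSphere ∧
    ∀ Y : AbstractSimplicialComplex V, Y.IsTriangulatedTwoSphere →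
      X.separationIndex ≤ Y.separationIndex

end AbstractSimplicialComplex

set_option linter.unusedSectionVars false

section

open Set Topology

/-- `f` has a continuous logarithm on `K`. -/
def HasLogOn {X : Type*} [TopologicalSpace X] (f : X → ℂ) (K : Set X) : Prop :=
  ∃ g : X → ℂ, ContinuousOn g K ∧ ∀ x ∈ K, Complex.exp (g x) = f x

/-- Every continuous nowhere vanishing complex function on `K` has a continuous logarithm. -/
def LogProperty {X : Type*} [TopologicalSpace X] (K : Set X) : Prop :=
  ∀ f : X → ℂ, ContinuousOn f K → (∀ x ∈ K, f x ≠ 0) → HasLogOn f K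

section Logarithms

variable {X : Type*} [TopologicalSpace X]

theorem HasLogOn.mono {f : X → ℂ} {K L : Set X} (h : HasLogOn f L) (hKL : K ⊆ L) :
    HasLogOn f K := by
  obtain ⟨g, hg, hgf⟩ := h
  exact ⟨g, hg.mono hKL, fun x hx => hgf x (hKL hx)⟩

theorem HasLogOn.congr {f f' : X → ℂ} {K : Set X} (h : HasLogOn f K) (hf : EqOn f f' K) :
    HasLogOn f' K := by
  obtain ⟨g, hg, hgf⟩ := h
  exact ⟨g, hg, fun x hx => (hgf x hx).trans (hf hx)⟩

theorem HasLogOn.comp {Y : Type*} [TopologicalSpace Y] {f : X → ℂ} {K : Set X} {L : Set Y}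
    (h : HasLogOn f K) {φ : Y → X} (hφ : ContinuousOn φ L) (hm : MapsTo φ L K) :
    HasLogOn (f ∘ φ) L := by
  obtain ⟨g, hg, hgf⟩ := h
  exact ⟨g ∘ φ, hg.comp hφ hm, fun x hx => hgf _ (hm hx)⟩

theorem HasLogOn.mul {f f' : X → ℂ} {K : Set X} (h : HasLogOn f K) (h' : HasLogOn f' K) :
    HasLogOn (fun x => f x * f' x) K := by
  obtain ⟨g, hg, hgf⟩ := h
  obtain ⟨g', hg', hgf'⟩ := h'
  exact ⟨fun x => g x + g' x, hg.add hg', fun x hx => by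
    rw [Complex.exp_add, hgf x hx, hgf' x hx]⟩

theorem HasLogOn.of_norm_sub_one_lt {f : X → ℂ} {K : Set X} (hf : ContinuousOn f K)
    (h : ∀ x ∈ K, ‖f x - 1‖ < 1) : HasLogOn f K := by
  have hs : ∀ x ∈ K, f x ∈ Complex.slitPlane := fun x hx => by
    have := Complex.mem_slitPlane_of_norm_lt_one (h x hx)
    simpa using this
  exact ⟨fun x => Complex.log (f x), hf.clog hs, fun x hx =>
    Complex.exp_log (Complex.slitPlane_ne_zero (hs x hx))⟩

theorem HasLogOn.const {c : ℂ} (hc : c ≠ 0) (K : Set X) : HasLogOn (fun _ => c) K :=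
  ⟨fun _ => Complex.log c, continuousOn_const, fun _ _ => Complex.exp_log hc⟩

theorem IsPreconnected.eq_of_exp_eq {S : Set X} (hS : IsPreconnected S) {h : X → ℂ}
    (hc : ContinuousOn h S) {x y : X} (he : ∀ z ∈ S, Complex.exp (h z) = Complex.exp (h x))
    (hx : x ∈ S) (hy : y ∈ S) : h x = h y := by
  have key : ∀ z ∈ S, ∃ n : ℤ, h z = h x + n * (2 * Real.pi * Complex.I) := fun z hz =>
    Complex.exp_eq_exp_iff_exists_int.1 (he z hz)
  have hT : IsDiscrete (AddSubgroup.zmultiples (2 * Real.pi) : Set ℝ) := by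
    rw [isDiscrete_iff_discreteTopology]
    exact inferInstanceAs (DiscreteTopology (AddSubgroup.zmultiples (2 * Real.pi)))
  have h1 := hS.constant_of_mapsTo hT (f := fun z => (h z - h x).im)
    (Complex.continuous_im.comp_continuousOn (hc.sub continuousOn_const)) (by
      intro z hz
      obtain ⟨n, hn⟩ := key z hz
      refine ⟨n, ?_⟩
      simp [hn]) hx hy
  obtain ⟨n, hn⟩ := key y hy
  have h2 : (n : ℝ) = 0 := by
    simp only [sub_self, Complex.zero_im, hn, add_sub_cancel_left] at h1
    simp at h1
    have := Real.pi_ne_zero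
    simp_all
  rw [hn]
  have : (n : ℂ) = 0 := by exact_mod_cast h2
  simp [this]

theorem HasLogOn.union {f : X → ℂ} {K L : Set X} (hK : IsClosed K) (hL : IsClosed L)
    (hc : IsPreconnected (K ∩ L)) (h : HasLogOn f K) (h' : HasLogOn f L) :
    HasLogOn f (K ∪ L) := by
  classical
  obtain ⟨g, hg, hgf⟩ := h
  obtain ⟨g', hg', hgf'⟩ := h'
  have key : ∃ c : ℂ, Complex.exp c = 1 ∧ ∀ x ∈ K ∩ L, g x = g' x + c := by
    rcases (K ∩ L).eq_empty_or_nonempty with he | ⟨x, hx⟩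
    · exact ⟨0, by simp, fun x hx => by simp [he] at hx⟩
    have he : ∀ z ∈ K ∩ L, Complex.exp (g z - g' z) = 1 := fun z hz => by
      have h1 : Complex.exp (g z) = Complex.exp (g' z) := by rw [hgf z hz.1, hgf' z hz.2]
      rw [Complex.exp_sub, h1, div_self (Complex.exp_ne_zero _)]
    refine ⟨g x - g' x, he x hx, fun y hy => ?_⟩
    have := hc.eq_of_exp_eq (h := fun z => g z - g' z)
      ((hg.mono inter_subset_left).sub (hg'.mono inter_subset_right))
      (fun z hz => by rw [he z hz, he x hx]) hx hy
    rw [this]; ring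
  obtain ⟨c, hc1, hgc⟩ := key
  have e1 : EqOn (fun x => if x ∈ K then g x else g' x + c) g K := fun x hx => if_pos hx
  have e2 : EqOn (fun x => if x ∈ K then g x else g' x + c) (fun x => g' x + c) L := by
    intro x hx
    by_cases hxK : x ∈ K
    · simp only [if_pos hxK]; exact hgc x ⟨hxK, hx⟩
    · simp only [if_neg hxK]
  refine ⟨fun x => if x ∈ K then g x else g' x + c, ?_, ?_⟩
  · exact (hg.congr e1).union_of_isClosed ((hg'.add continuousOn_const).congr e2) hK hL
  · rintro x (hx | hx)
    · rw [e1 hx, hgf x hx]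
    · rw [e2 hx, Complex.exp_add, hc1, mul_one, hgf' x hx]

theorem LogProperty.of_finite [T1Space X] {K : Set X} (hK : K.Finite) : LogProperty K := by
  intro f _ h0
  exact ⟨fun x => Complex.log (f x), hK.continuousOn _, fun x hx => Complex.exp_log (h0 x hx)⟩

end Logarithms

theorem LogProperty.of_starConvex {E : Type*} [NormedAddCommGroup E] [NormedSpace ℝ E]
    {K : Set E} (hK : IsCompact K) {x₀ : E} (hs : StarConvex ℝ x₀ K) : LogProperty K := by
  intro f hf h0
  rcases K.eq_empty_or_nonempty with rfl | hne
  · exact ⟨fun _ => 0, continuousOn_empty _, by simp⟩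
  have hx₀ : x₀ ∈ K := hs.mem hne
  obtain ⟨z, hz, hzm⟩ := hK.exists_isMinOn hne hf.norm
  have hm : 0 < ‖f z‖ := norm_pos_iff.2 (h0 z hz)
  obtain ⟨δ, hδ, huc⟩ := Metric.uniformContinuousOn_iff.1
    (hK.uniformContinuousOn_of_continuous hf) ‖f z‖ hm
  obtain ⟨R, hR⟩ := hK.isBounded.subset_ball x₀
  obtain ⟨N, hN⟩ := exists_nat_gt (R / δ)
  have hRpos : 0 < R := by
    have := hR hx₀
    simpa using this
  have hNpos : (0 : ℝ) < N := lt_trans (by positivity) hN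
  set p : ℕ → E → E := fun i x => x₀ + ((i : ℝ) / N) • (x - x₀) with hp
  have hpK : ∀ i ≤ N, ∀ x ∈ K, p i x ∈ K := fun i hi x hx => by
    apply hs.add_smul_sub_mem hx (by positivity)
    rw [div_le_one hNpos]; exact_mod_cast hi
  have hpc : ∀ i, Continuous (p i) := fun i => by simp only [hp]; fun_prop
  have hfc : ∀ i ≤ N, ContinuousOn (fun x => f (p i x)) K := fun i hi =>
    hf.comp (hpc i).continuousOn (hpK i hi)
  have hratio : ∀ i < N, HasLogOn (fun x => f (p (i + 1) x) / f (p i x)) K := by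
    intro i hi
    apply HasLogOn.of_norm_sub_one_lt
    · exact (hfc (i + 1) hi).div (hfc i hi.le) fun x hx => h0 _ (hpK i hi.le x hx)
    · intro x hx
      have hne := h0 _ (hpK i hi.le x hx)
      have hd : dist (p (i + 1) x) (p i x) < δ := by
        rw [dist_eq_norm]
        have : p (i + 1) x - p i x = ((1 : ℝ) / N) • (x - x₀) := by
          simp only [hp, add_sub_add_left_eq_sub, ← sub_smul]
          congr 1; push_cast; ring
        rw [this, norm_smul, Real.norm_of_nonneg (by positivity)]
        have hxR : ‖x - x₀‖ < R := by simpa [dist_eq_norm] using hR hx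
        have : R < δ * N := by rw [div_lt_iff₀ hδ] at hN; linarith
        rw [one_div, inv_mul_lt_iff₀ hNpos]; linarith
      have h1 := huc _ (hpK _ hi x hx) _ (hpK _ hi.le x hx) hd
      rw [div_sub_one hne, norm_div, div_lt_one (norm_pos_iff.2 hne), ← dist_eq_norm]
      exact h1.trans_le (hzm (hpK _ hi.le x hx))
  have main : ∀ i ≤ N, HasLogOn (fun x => f (p i x)) K := by
    intro i
    induction i with
    | zero =>
      intro _
      have : (fun x => f (p 0 x)) = fun _ => f x₀ := by funext x; simp [hp]
      rw [this]; exact HasLogOn.const (h0 _ hx₀) K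
    | succ i ih =>
      intro hi
      refine ((ih (by omega)).mul (hratio i hi)).congr fun x hx => ?_
      have := h0 _ (hpK i (by omega) x hx)
      simp only; field_simp
  refine (main N le_rfl).congr fun x hx => ?_
  have : p N x = x := by simp [hp, div_self hNpos.ne']
  simp only [this]

theorem not_hasLogOn_sphere (p : ℂ) {R : ℝ} (hR : 0 < R) :
    ¬ HasLogOn (fun z => z - p) (Metric.sphere p R) := by
  rintro ⟨g, hg, hgf⟩
  have hmem : ∀ t : ℝ, p + R * Complex.exp (t * Complex.I) ∈ Metric.sphere p R := fun t => by
    simp [Complex.norm_exp_ofReal_mul_I, abs_of_pos hR]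
  have hh : ∀ t : ℝ, Complex.exp (g (p + R * Complex.exp (t * Complex.I)) - t * Complex.I) = R := by
    intro t
    rw [Complex.exp_sub, hgf _ (hmem t)]
    field_simp [Complex.exp_ne_zero]
    ring
  have := isPreconnected_univ.eq_of_exp_eq (X := ℝ)
    (h := fun t => g (p + R * Complex.exp (t * Complex.I)) - t * Complex.I) (x := 0)
    (y := 2 * Real.pi)
    ((hg.comp_continuous (by fun_prop) hmem).sub (by fun_prop)).continuousOn
    (fun z _ => by rw [hh, hh]) trivial trivial
  have h2 := Complex.two_pi_I_ne_zero
  simp [Complex.exp_two_pi_mul_I] at this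
  exact h2 (by linear_combination this)

/-- A bounded complementary component obstructs the existence of a logarithm. -/
theorem not_hasLogOn_of_isBounded {K Ω : Set ℂ} (hK : IsClosed K) (hΩ : IsOpen Ω)
    (hKΩ : IsClosed (K ∪ Ω)) (hb : Bornology.IsBounded Ω) {p : ℂ}
    (hp : p ∈ Ω) : ¬ HasLogOn (fun z => z - p) K := by
  classical
  rintro ⟨g, hg, hgf⟩
  obtain ⟨G, hG⟩ := ContinuousMap.exists_restrict_eq hK ⟨K.domRestrict g, hg.domRestrict⟩
  have hGg : ∀ z ∈ K, G z = g z := fun z hz => congr($hG ⟨z, hz⟩)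
  let F : ℂ → ℂ := fun z => if z ∈ Ω then Complex.exp (G z) else z - p
  have e1 : EqOn F (fun z => Complex.exp (G z)) (K ∪ Ω) := by
    intro z hz
    by_cases hzΩ : z ∈ Ω
    · simp [F, hzΩ]
    · have hzK : z ∈ K := hz.resolve_right hzΩ
      simp [F, hzΩ, hGg z hzK, hgf z hzK]
  have e2 : EqOn F (fun z => z - p) Ωᶜ := fun z hz => if_neg hz
  have hF : Continuous F := by
    rw [← continuousOn_univ]
    have : (univ : Set ℂ) = (K ∪ Ω) ∪ Ωᶜ := by
      rw [union_assoc, union_compl_self, union_univ]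
    rw [this]
    exact ((by fun_prop : Continuous fun z => Complex.exp (G z)).continuousOn.congr e1
      ).union_of_isClosed ((by fun_prop : Continuous fun z => z - p).continuousOn.congr e2)
      hKΩ hΩ.isClosed_compl
  have hF0 : ∀ z, F z ≠ 0 := fun z => by
    by_cases hz : z ∈ Ω
    · simp [F, hz]
    · simp only [F, hz, if_false]
      exact sub_ne_zero.2 fun h => hz (h ▸ hp)
  obtain ⟨R, hR⟩ := hb.subset_ball p
  have hRpos : 0 < R := by simpa using hR hp
  have hlog := LogProperty.of_starConvex (isCompact_closedBall p R)
    ((convex_closedBall p R).starConvex (Metric.mem_closedBall_self hRpos.le)) F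
    hF.continuousOn fun z _ => hF0 z
  refine not_hasLogOn_sphere p hRpos ((hlog.mono Metric.sphere_subset_closedBall).congr ?_)
  intro z hz
  apply e2
  intro hzΩ
  have := hR hzΩ
  simp [dist_eq_norm] at this hz
  linarith

theorem hasLogOn_of_isPreconnected {A K : Set ℂ} (hA : IsClosed A) (hAc : IsPreconnected A)
    (hAb : ¬ Bornology.IsBounded A) (hK : IsCompact K) (hd : Disjoint K A) {a : ℂ} (ha : a ∈ A) :
    HasLogOn (fun z => z - a) K := by
  obtain ⟨ε, hε, hdist⟩ : ∃ ε : ℝ, 0 < ε ∧ ∀ z ∈ K, ∀ b ∈ A, ε < dist z b := by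
    obtain ⟨r, hr, h⟩ := Metric.exists_pos_forall_lt_edist hK hA hd
    refine ⟨r, hr, fun z hz b hb => ?_⟩
    have := h z hz b hb
    rw [edist_nndist] at this
    have h2 : r < nndist z b := by exact_mod_cast this
    rw [← coe_nndist]; exact_mod_cast h2
  have step : ∀ b ∈ A, ∀ c ∈ A, dist b c < ε → HasLogOn (fun z => z - b) K →
      HasLogOn (fun z => z - c) K := by
    intro b hb c hc hbc h
    have hne : ∀ z ∈ K, z - b ≠ 0 := fun z hz h0 => by
      have := hdist z hz b hb
      rw [dist_eq_norm, h0] at this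
      simp at this; linarith
    refine (h.mul (f' := fun z => (z - c) / (z - b)) (HasLogOn.of_norm_sub_one_lt ?_ ?_)).congr ?_
    · exact ContinuousOn.div (by fun_prop) (by fun_prop) hne
    · intro z hz
      rw [div_sub_one (hne z hz), norm_div, div_lt_one (norm_pos_iff.2 (hne z hz)),
        sub_sub_sub_cancel_left, ← dist_eq_norm, ← dist_eq_norm]
      exact hbc.trans (hdist z hz b hb)
    · intro z hz
      have := hne z hz
      simp only; field_simp
  obtain ⟨R, hR⟩ := hK.isBounded.subset_ball 0
  obtain ⟨b, hb, hbR⟩ : ∃ b ∈ A, max R 0 < ‖b‖ := by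
    by_contra! h
    exact hAb (isBounded_iff_forall_norm_le.2 ⟨_, h⟩)
  have hb0 : b ≠ 0 := by
    rintro rfl; simp at hbR
  have hPb : HasLogOn (fun z => z - b) K := by
    refine ((HasLogOn.const (neg_ne_zero.2 hb0) K).mul (f' := fun z => 1 - z / b)
      (HasLogOn.of_norm_sub_one_lt (by fun_prop) ?_)).congr ?_
    · intro z hz
      have h1 : ‖z‖ < R := by simpa using hR hz
      have h2 := (le_max_left R 0).trans_lt hbR
      rw [sub_sub_cancel_left, norm_neg, norm_div, div_lt_one (norm_pos_iff.2 hb0)]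
      linarith
    · intro z _
      simp only; field_simp; ring
  by_contra hPa
  have := hAc {x | ∃ c ∈ A, HasLogOn (fun z => z - c) K ∧ dist x c < ε / 2}
    {x | ∃ c ∈ A, ¬ HasLogOn (fun z => z - c) K ∧ dist x c < ε / 2} ?_ ?_ ?_ ?_ ?_
  · obtain ⟨x, hx, ⟨c, hc, hPc, hxc⟩, ⟨c', hc', hPc', hxc'⟩⟩ := this
    refine hPc' (step c hc c' hc' ?_ hPc)
    have := dist_triangle_left c c' x
    linarith
  · have : {x | ∃ c ∈ A, HasLogOn (fun z => z - c) K ∧ dist x c < ε / 2} =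
      ⋃ c ∈ {c ∈ A | HasLogOn (fun z => z - c) K}, Metric.ball c (ε / 2) := by
      ext x; simp [and_assoc]
    rw [this]; exact isOpen_biUnion fun _ _ => Metric.isOpen_ball
  · have : {x | ∃ c ∈ A, ¬ HasLogOn (fun z => z - c) K ∧ dist x c < ε / 2} =
      ⋃ c ∈ {c ∈ A | ¬ HasLogOn (fun z => z - c) K}, Metric.ball c (ε / 2) := by
      ext x; simp [and_assoc]
    rw [this]; exact isOpen_biUnion fun _ _ => Metric.isOpen_ball
  · intro c hc
    by_cases h : HasLogOn (fun z => z - c) K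
    · exact Or.inl ⟨c, hc, h, by simpa using hε⟩
    · exact Or.inr ⟨c, hc, h, by simpa using hε⟩
  · exact ⟨b, hb, b, hb, hPb, by simpa using hε⟩
  · exact ⟨a, ha, a, ha, hPa, by simpa using hε⟩

theorem exists_isCompact_isPreconnected_superset {W K : Set ℂ} (hW : IsOpen W)
    (hWc : IsPreconnected W) (hK : IsCompact K) (hKW : K ⊆ W) :
    ∃ L, IsCompact L ∧ IsPreconnected L ∧ K ⊆ L ∧ L ⊆ W := by
  suffices h : ∃ L, IsCompact L ∧ IsPreconnected L ∧ K ⊆ L ∧ L ⊆ W from h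
  refine hK.induction_on (p := fun t => ∃ L, IsCompact L ∧ IsPreconnected L ∧ t ⊆ L ∧ L ⊆ W)
    ⟨∅, isCompact_empty, isPreconnected_empty, by simp, by simp⟩ ?_ ?_ ?_
  · rintro s t hst ⟨L, h1, h2, h3, h4⟩
    exact ⟨L, h1, h2, hst.trans h3, h4⟩
  · rintro s t ⟨L, h1, h2, h3, h4⟩ ⟨M, k1, k2, k3, k4⟩
    rcases L.eq_empty_or_nonempty with rfl | ⟨x, hx⟩
    · exact ⟨M, k1, k2, union_subset (h3.trans (empty_subset _)) k3, k4⟩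
    rcases M.eq_empty_or_nonempty with rfl | ⟨y, hy⟩
    · exact ⟨L, h1, h2, union_subset h3 (k3.trans (empty_subset _)), h4⟩
    have hpc : IsPathConnected W := hW.isConnected_iff_isPathConnected.1 ⟨⟨x, h4 hx⟩, hWc⟩
    obtain ⟨γ, hγ⟩ := hpc.joinedIn x (h4 hx) y (k4 hy)
    have hγc : IsPreconnected (range γ) := isPreconnected_range γ.continuous
    refine ⟨L ∪ range γ ∪ M, (h1.union (isCompact_range γ.continuous)).union k1, ?_,
      union_subset_union (h3.trans subset_union_left) k3,
      union_subset (union_subset h4 (range_subset_iff.2 hγ)) k4⟩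
    have hxγ : x ∈ range γ := ⟨0, γ.source⟩
    have hyγ : y ∈ range γ := ⟨1, γ.target⟩
    exact (h2.union x hx hxγ hγc).union y (Or.inr hyγ) hy k2
  · intro x hx
    obtain ⟨r, hr, hrW⟩ := Metric.nhds_basis_closedBall.mem_iff.1 (hW.mem_nhds (hKW hx))
    exact ⟨_, mem_nhdsWithin_of_mem_nhds (Metric.closedBall_mem_nhds x hr), _,
      isCompact_closedBall x r, (convex_closedBall x r).isPreconnected, Subset.rfl, hrW⟩

/-- Two closed connected sets joining `a` to infinity and meeting only in `a` separate the plane. -/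
theorem not_isPreconnected_compl_union {A B : Set ℂ} {a : ℂ} (hA : IsClosed A) (hB : IsClosed B)
    (hAc : IsPreconnected A) (hBc : IsPreconnected B) (hAb : ¬ Bornology.IsBounded A)
    (hBb : ¬ Bornology.IsBounded B) (hAB : A ∩ B = {a}) : ¬ IsPreconnected (A ∪ B)ᶜ := by
  intro hW
  have haA : a ∈ A ∩ B := by simp [hAB]
  have hcover : Metric.sphere a 1 ⊆ Aᶜ ∪ Bᶜ := by
    rw [← compl_inter, hAB]
    intro z hz hza
    rw [mem_singleton_iff.1 hza] at hz
    simp at hz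
  obtain ⟨K₁, K₂, hK₁, hK₂, hK₁A, hK₂B, hK⟩ :=
    (isCompact_sphere a 1).binary_compact_cover hA.isOpen_compl hB.isOpen_compl hcover
  obtain ⟨L, hL, hLc, hKL, hLW⟩ := exists_isCompact_isPreconnected_superset
    (hA.union hB).isOpen_compl hW (hK₁.inter hK₂)
    (fun z hz => by simpa using ⟨hK₁A hz.1, hK₂B hz.2⟩)
  rw [compl_union] at hLW
  have h1 := hasLogOn_of_isPreconnected hA hAc hAb (hK₁.union hL)
    (disjoint_left.2 fun z hz => hz.elim (fun h => hK₁A h) (fun h => (hLW h).1)) haA.1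
  have h2 := hasLogOn_of_isPreconnected hB hBc hBb (hK₂.union hL)
    (disjoint_left.2 fun z hz => hz.elim (fun h => hK₂B h) (fun h => (hLW h).2)) haA.2
  refine not_hasLogOn_sphere a one_pos ((HasLogOn.union (hK₁.union hL).isClosed
    (hK₂.union hL).isClosed ?_ h1 h2).mono ?_)
  · rwa [← inter_union_distrib_right, union_eq_right.2 hKL]
  · rw [hK]
    exact union_subset_union subset_union_left subset_union_left

/-- A compact set which becomes a plane whenever one of its points is removed. -/
structure IsPlaneCompactification {E : Type*} [TopologicalSpace E] (S : Set E) : Prop where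
  isCompact : IsCompact S
  exists_chart : ∀ q ∈ S, ∃ (ψ : E → ℂ) (θ : ℂ → E), ContinuousOn ψ (S \ {q}) ∧ Continuous θ ∧
    (∀ z, θ z ∈ S \ {q}) ∧ (∀ z, ψ (θ z) = z) ∧ ∀ x ∈ S \ {q}, θ (ψ x) = x

section

variable {E : Type*} [TopologicalSpace E] {S : Set E}

theorem IsPlaneCompactification.of_homeomorph [T2Space E]
    (h : S ≃ₜ Metric.sphere (0 : EuclideanSpace ℝ (Fin 3)) 1) : IsPlaneCompactification S := by
  classical
  have : Fact (Module.finrank ℝ (EuclideanSpace ℝ (Fin 3)) = 2 + 1) := ⟨by simp⟩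
  refine ⟨isCompact_iff_compactSpace.2 h.symm.compactSpace, fun q hq => ?_⟩
  let e := stereographic' 2 (h ⟨q, hq⟩)
  let c : EuclideanSpace ℝ (Fin 2) ≃ₜ ℂ :=
    Complex.orthonormalBasisOneI.repr.toHomeomorph.symm
  have hsrc : e.source = {h ⟨q, hq⟩}ᶜ := stereographic'_source _
  have htgt : e.target = univ := stereographic'_target _
  have hmem : ∀ y, e.symm y ≠ h ⟨q, hq⟩ := fun y => by
    have := e.map_target (x := y) (by simp [htgt])
    simpa [hsrc] using this
  let ψ : E → ℂ := fun x => if hx : x ∈ S then c (e (h ⟨x, hx⟩)) else 0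
  have hψ : ∀ x (hx : x ∈ S), ψ x = c (e (h ⟨x, hx⟩)) := fun x hx => dif_pos hx
  refine ⟨ψ, fun z => (h.symm (e.symm (c.symm z)) : E), ?_, ?_, ?_, ?_, ?_⟩
  · rw [continuousOn_iff_continuous_domRestrict]
    have : (S \ {q}).domRestrict ψ = fun x : (S \ {q} : Set E) => c (e (h ⟨x.1, x.2.1⟩)) := by
      funext x; exact hψ x.1 x.2.1
    rw [this]
    refine c.continuous.comp (e.continuousOn.comp_continuous (h.continuous.comp (by fun_prop)) ?_)
    intro x
    rw [hsrc, mem_compl_singleton_iff]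
    intro hx
    exact x.2.2 (congrArg Subtype.val (h.injective hx))
  · refine continuous_subtype_val.comp (h.symm.continuous.comp ?_)
    have : Continuous e.symm := by
      rw [← continuousOn_univ, ← htgt]; exact e.continuousOn_symm
    exact this.comp c.symm.continuous
  · intro z
    refine ⟨Subtype.coe_prop _, fun hz => hmem (c.symm z) ?_⟩
    rw [← h.symm_apply_eq]
    exact Subtype.ext hz
  · intro z
    rw [hψ _ (Subtype.coe_prop _)]
    simp [e.right_inv (x := c.symm z) (by simp [htgt])]
  · rintro x ⟨hx, hxq⟩
    rw [hψ x hx]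
    have : h ⟨x, hx⟩ ∈ e.source := by
      rw [hsrc, mem_compl_singleton_iff]
      exact fun hh => hxq (congrArg Subtype.val (h.injective hh))
    simp [e.left_inv this]

/-- A closed set with the logarithm property does not separate the sphere. -/
theorem IsPlaneCompactification.isPreconnected_diff [T2Space E] (hS : IsPlaneCompactification S)
    {K : Set E} (hK : IsClosed K) (hKS : K ⊆ S) (hlog : LogProperty K) :
    IsPreconnected (S \ K) := by
  intro U V hU hV hUV ⟨p, hp, hpU⟩ ⟨q, hq, hqV⟩
  by_contra hne
  have hdisj : ∀ x ∈ S, x ∉ K → x ∈ U → x ∉ V := fun x h1 h2 h3 h4 => hne ⟨x, ⟨h1, h2⟩, h3, h4⟩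
  obtain ⟨ψ, θ, hψ, hθ, hθS, hψθ, hθψ⟩ := hS.exists_chart q hq.1
  have hpq : p ≠ q := by rintro rfl; exact hdisj p hp.1 hp.2 hpU hqV
  have hKq : K ⊆ S \ {q} := fun x hx => ⟨hKS hx, fun h => hq.2 (h ▸ hx)⟩
  have hU' : ∀ z, θ z ∉ K → (θ z ∈ U ↔ θ z ∉ V) := fun z hz =>
    ⟨hdisj _ (hθS z).1 hz, fun h => (hUV ⟨(hθS z).1, hz⟩).resolve_right h⟩
  have hcl : θ ⁻¹' K ∪ θ ⁻¹' (U \ K) = (θ ⁻¹' (V \ K))ᶜ := by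
    ext z
    have := hU' z
    simp only [mem_union, mem_preimage, mem_sdiff, mem_compl_iff]
    tauto
  have hb : Bornology.IsBounded (θ ⁻¹' (U \ K)) := by
    have hc : IsCompact (S \ (V \ K)) := hS.isCompact.diff (hV.sdiff hK)
    have hcq : S \ (V \ K) ⊆ S \ {q} := fun x hx => ⟨hx.1, fun h => hx.2 (h ▸ ⟨hqV, hq.2⟩)⟩
    refine (hc.image_of_continuousOn (hψ.mono hcq)).isBounded.subset fun z hz => ?_
    exact ⟨θ z, ⟨(hθS z).1, fun h => (hU' z hz.2).1 hz.1 h.1⟩, hψθ z⟩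
  refine not_hasLogOn_of_isBounded (hK.preimage hθ) ((hU.sdiff hK).preimage hθ)
    (hcl ▸ ((hV.sdiff hK).preimage hθ).isClosed_compl) hb (p := ψ p) ?_ ?_
  · have := hθψ p ⟨hp.1, hpq⟩
    simp only [mem_preimage, this]
    exact ⟨hpU, hp.2⟩
  · have h1 := hlog (fun x => ψ x - ψ p) ((hψ.mono hKq).sub continuousOn_const) (fun x hx h0 => by
      have h2 := sub_eq_zero.1 h0
      have h3 := hθψ x (hKq hx)
      rw [h2, hθψ p ⟨hp.1, hpq⟩] at h3
      exact hp.2 (h3 ▸ hx))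
    refine (h1.comp (φ := θ) hθ.continuousOn (fun z hz => hz)).congr fun z _ => ?_
    simp [hψθ]

/-- Two arcs with the same end points and no other common points separate the sphere. -/
theorem IsPlaneCompactification.not_isPreconnected_diff [T2Space E]
    (hS : IsPlaneCompactification S) {A B : Set E} (hA : IsClosed A) (hB : IsClosed B)
    (hAS : A ⊆ S) (hBS : B ⊆ S) {p q : E} (hpq : p ≠ q) (hAB : A ∩ B = {p, q})
    (hAc : IsPreconnected (A \ {q})) (hBc : IsPreconnected (B \ {q}))
    (hAq : q ∈ closure (A \ {q})) (hBq : q ∈ closure (B \ {q})) :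
    ¬ IsPreconnected (S \ (A ∪ B)) := by
  intro hW
  have hp : p ∈ A ∩ B := by simp [hAB]
  have hq : q ∈ A ∩ B := by simp [hAB]
  obtain ⟨ψ, θ, hψ, hθ, hθS, hψθ, hθψ⟩ := hS.exists_chart q (hAS hq.1)
  have himg : ∀ T : Set E, T ⊆ S → θ ⁻¹' T = ψ '' (T \ {q}) := by
    intro T hT
    ext z
    refine ⟨fun hz => ⟨θ z, ⟨hz, (hθS z).2⟩, hψθ z⟩, ?_⟩
    rintro ⟨x, hx, rfl⟩
    rw [mem_preimage, hθψ x ⟨hT hx.1, hx.2⟩]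
    exact hx.1
  have hunb : ∀ T : Set E, T ⊆ S → q ∈ closure (T \ {q}) → ¬ Bornology.IsBounded (θ ⁻¹' T) := by
    intro T hT hTq hb
    have hc : IsCompact (θ '' closure (θ ⁻¹' T)) := hb.isCompact_closure.image hθ
    have hsub : T \ {q} ⊆ θ '' closure (θ ⁻¹' T) := by
      intro x hx
      have h1 := hθψ x ⟨hT hx.1, hx.2⟩
      exact ⟨ψ x, subset_closure (by rw [mem_preimage, h1]; exact hx.1), h1⟩
    obtain ⟨z, _, hz⟩ := closure_minimal hsub hc.isClosed hTq
    exact (hθS z).2 hz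
  have hconn : ∀ T : Set E, T ⊆ S → IsPreconnected (T \ {q}) → IsPreconnected (θ ⁻¹' T) := by
    intro T hT hc
    rw [himg T hT]
    exact hc.image ψ (hψ.mono (sdiff_subset_sdiff_left hT))
  refine not_isPreconnected_compl_union (a := ψ p) (hA.preimage hθ) (hB.preimage hθ)
    (hconn A hAS hAc) (hconn B hBS hBc) (hunb A hAS hAq) (hunb B hBS hBq) ?_ ?_
  · rw [← preimage_inter, hAB, himg _ (by rw [← hAB]; exact inter_subset_left.trans hAS)]
    have : ({p, q} : Set E) \ {q} = {p} := by
      ext x; simp only [mem_sdiff, mem_insert_iff, mem_singleton_iff]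
      constructor
      · tauto
      · rintro rfl; exact ⟨Or.inl rfl, hpq⟩
    rw [this, image_singleton]
  · have h1 : (θ ⁻¹' A ∪ θ ⁻¹' B)ᶜ = θ ⁻¹' (S \ (A ∪ B)) := by
      ext z
      simp [(hθS z).1]
    rw [h1]
    apply hconn _ sdiff_subset
    rwa [sdiff_singleton_eq_self (fun h => h.2 (Or.inl hq.1))]

end

section Cells

variable {V : Type*} [Fintype V]

/-- The closed face of the standard simplex spanned by `σ`. -/
def stdCell (σ : Finset V) : Set (V → ℝ) := {x | x ∈ stdSimplex ℝ V ∧ ∀ v, v ∉ σ → x v = 0}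

theorem convex_stdCell (σ : Finset V) : Convex ℝ (stdCell σ) := by
  intro x hx y hy a b ha hb hab
  refine ⟨convex_stdSimplex ℝ V hx.1 hy.1 ha hb hab, fun v hv => ?_⟩
  simp [hx.2 v hv, hy.2 v hv]

theorem isCompact_stdCell (σ : Finset V) : IsCompact (stdCell σ) := by
  have : stdCell σ = stdSimplex ℝ V ∩ ⋂ v, ⋂ _ : v ∉ σ, {x | x v = 0} := by
    ext x; simp [stdCell]
  rw [this]
  refine (isCompact_stdSimplex ℝ V).inter_right (isClosed_iInter fun v => isClosed_iInter fun _ => ?_)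
  exact isClosed_eq (continuous_apply v) continuous_const

theorem isClosed_stdCell (σ : Finset V) : IsClosed (stdCell σ) := (isCompact_stdCell σ).isClosed

theorem stdCell_mono {σ τ : Finset V} (h : σ ⊆ τ) : stdCell σ ⊆ stdCell τ :=
  fun _ hx => ⟨hx.1, fun v hv => hx.2 v fun h' => hv (h h')⟩

theorem stdCell_inter [DecidableEq V] (σ τ : Finset V) :
    stdCell σ ∩ stdCell τ = stdCell (σ ∩ τ) := by
  ext x
  simp only [stdCell, mem_inter_iff, mem_ofPred_eq, Finset.mem_inter]
  constructor
  · rintro ⟨⟨h, h1⟩, _, h2⟩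
    refine ⟨h, fun v hv => ?_⟩
    by_cases hs : v ∈ σ
    · exact h2 v fun ht => hv ⟨hs, ht⟩
    · exact h1 v hs
  · rintro ⟨h, h1⟩
    exact ⟨⟨h, fun v hv => h1 v fun h' => hv h'.1⟩, h, fun v hv => h1 v fun h' => hv h'.2⟩

theorem nonneg_of_mem_stdCell {σ : Finset V} {x : V → ℝ} (hx : x ∈ stdCell σ) (v : V) :
    0 ≤ x v := hx.1.1 v

theorem sum_of_mem_stdCell {σ : Finset V} {x : V → ℝ} (hx : x ∈ stdCell σ) :
    ∑ v ∈ σ, x v = 1 := by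
  rw [← hx.1.2]
  exact Finset.sum_subset (Finset.subset_univ _) fun v _ hv => hx.2 v hv

/-- The set of vertices at which a point has nonzero barycentric coordinate. -/
noncomputable def coordSupport (x : V → ℝ) : Finset V := by
  classical exact {v | x v ≠ 0}

theorem mem_coordSupport {x : V → ℝ} {v : V} : v ∈ coordSupport x ↔ x v ≠ 0 := by
  simp [coordSupport]

theorem mem_stdCell_iff {σ : Finset V} {x : V → ℝ} :
    x ∈ stdCell σ ↔ x ∈ stdSimplex ℝ V ∧ coordSupport x ⊆ σ := by
  refine and_congr_right fun _ => forall_congr' fun v => ?_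
  rw [mem_coordSupport]
  tauto

theorem coordSupport_nonempty {x : V → ℝ} (hx : x ∈ stdSimplex ℝ V) :
    (coordSupport x).Nonempty := by
  by_contra h
  have h0 : ∀ v, x v = 0 := fun v => by
    by_contra hv
    exact h ⟨v, mem_coordSupport.2 hv⟩
  have := hx.2
  simp [h0] at this

/-- The barycenter of the face spanned by `σ`. -/
noncomputable def barycenter (σ : Finset V) : V → ℝ := by
  classical exact fun v => if v ∈ σ then (σ.card : ℝ)⁻¹ else 0

theorem barycenter_pos {σ : Finset V} {v : V} (hv : v ∈ σ) : 0 < barycenter σ v := by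
  have : 0 < σ.card := Finset.card_pos.2 ⟨v, hv⟩
  simp [barycenter, hv, this]

theorem barycenter_eq_zero {σ : Finset V} {v : V} (hv : v ∉ σ) : barycenter σ v = 0 := by
  simp [barycenter, hv]

theorem barycenter_mem {σ : Finset V} (hσ : σ.Nonempty) : barycenter σ ∈ stdCell σ := by
  refine ⟨⟨fun v => ?_, ?_⟩, fun v => barycenter_eq_zero⟩
  · by_cases hv : v ∈ σ
    · exact (barycenter_pos hv).le
    · exact (barycenter_eq_zero hv).ge
  · have : (σ.card : ℝ) ≠ 0 := by exact_mod_cast hσ.card_pos.ne'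
    simp [barycenter, this]

theorem barycenter_mem_iff {σ τ : Finset V} (hσ : σ.Nonempty) :
    barycenter σ ∈ stdCell τ ↔ σ ⊆ τ := by
  refine ⟨fun h v hv => ?_, fun h => stdCell_mono h (barycenter_mem hσ)⟩
  by_contra hvτ
  exact (barycenter_pos hv).ne' (h.2 v hvτ)

theorem eq_barycenter_singleton {x : V → ℝ} {a : V} (hx : x ∈ stdCell {a}) :
    x = barycenter {a} := by
  have h1 := sum_of_mem_stdCell hx
  rw [Finset.sum_singleton] at h1
  funext v
  by_cases hv : v ∈ ({a} : Finset V)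
  · rw [Finset.mem_singleton] at hv
    subst hv
    simp [barycenter, h1]
  · rw [hx.2 v hv, barycenter_eq_zero hv]

theorem stdCell_singleton (a : V) : stdCell {a} = {barycenter {a}} :=
  Subset.antisymm (fun _ hx => eq_barycenter_singleton hx)
    (singleton_subset_iff.2 (barycenter_mem (Finset.singleton_nonempty a)))

theorem convex_stdCell_pos (σ : Finset V) (a : V) : Convex ℝ {x ∈ stdCell σ | 0 < x a} :=
  (convex_stdCell σ).inter
    (convex_halfSpace_gt (f := fun x : V → ℝ => x a) ⟨fun _ _ => rfl, fun _ _ => rfl⟩ 0)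

theorem convex_stdCell_pos_pos (σ : Finset V) (a b : V) :
    Convex ℝ {x ∈ stdCell σ | 0 < x a ∧ 0 < x b} := by
  have := (convex_stdCell_pos σ a).inter (convex_stdCell_pos σ b)
  convert this using 1
  ext x; simp only [mem_ofPred_eq, mem_inter_iff]; tauto

theorem mem_closure_openSegment (x y : V → ℝ) : y ∈ closure (openSegment ℝ x y) := by
  rw [closure_openSegment]; exact right_mem_segment ℝ x y

theorem logProperty_union_stdCell {σ τ : Finset V} {x : V → ℝ} (h1 : x ∈ stdCell σ)
    (h2 : x ∈ stdCell τ) : LogProperty (stdCell σ ∪ stdCell τ) :=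
  LogProperty.of_starConvex ((isCompact_stdCell σ).union (isCompact_stdCell τ))
    (((convex_stdCell σ).starConvex h1).union ((convex_stdCell τ).starConvex h2))

variable [DecidableEq V]

theorem mem_stdCell_erase {σ : Finset V} {x : V → ℝ} {a : V} (hx : x ∈ stdCell σ) (ha : x a = 0) :
    x ∈ stdCell (σ.erase a) := by
  refine ⟨hx.1, fun v hv => ?_⟩
  by_cases hva : v = a
  · rw [hva, ha]
  · exact hx.2 v fun h => hv (Finset.mem_erase.2 ⟨hva, h⟩)

theorem stdCell_pair_diff {a b : V} (hab : a ≠ b) :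
    stdCell {a, b} \ {barycenter {b}} = {x ∈ stdCell {a, b} | 0 < x a} := by
  ext x
  simp only [mem_sdiff, mem_singleton_iff, mem_ofPred_eq]
  refine and_congr_right fun hx => ⟨fun h => ?_, ?_⟩
  · refine (nonneg_of_mem_stdCell hx a).lt_of_ne fun h0 => h (eq_barycenter_singleton ?_)
    have := mem_stdCell_erase hx h0.symm
    rwa [Finset.erase_insert (by simpa using hab)] at this
  · rintro h rfl
    rw [barycenter_eq_zero (by simpa using hab)] at h
    exact h.false

theorem isPreconnected_stdCell_pair_diff {a b : V} (hab : a ≠ b) :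
    IsPreconnected (stdCell {a, b} \ {barycenter {b}}) := by
  rw [stdCell_pair_diff hab]
  exact (convex_stdCell_pos _ _).isPreconnected

theorem barycenter_mem_closure_stdCell_pair_diff {a b : V} (hab : a ≠ b) :
    barycenter {b} ∈ closure (stdCell {a, b} \ {barycenter {b}}) := by
  refine closure_mono ?_ (mem_closure_openSegment (barycenter {a}) (barycenter {b}))
  rw [stdCell_pair_diff hab]
  have ha : barycenter {a} ∈ stdCell {a, b} := (barycenter_mem_iff (by simp)).2 (by simp)
  have hb : barycenter {b} ∈ stdCell {a, b} := (barycenter_mem_iff (by simp)).2 (by simp)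
  rintro x ⟨s, t, hs, ht, hst, rfl⟩
  refine ⟨convex_stdCell _ ha hb hs.le ht.le hst, ?_⟩
  have := barycenter_pos (Finset.mem_singleton_self a)
  simp [barycenter_eq_zero (σ := {b}) (v := a) (by simpa using hab)]
  positivity

theorem isPreconnected_union_stdCell_pair_diff {a b c : V} (hab : a ≠ b) (hcb : c ≠ b) :
    IsPreconnected ((stdCell {a, c} ∪ stdCell {c, b}) \ {barycenter {b}}) := by
  have hn : barycenter {b} ∉ stdCell {a, c} := by
    rw [barycenter_mem_iff (by simp)]
    simp [hab.symm, hcb.symm]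
  rw [union_sdiff_distrib, sdiff_singleton_eq_self hn]
  have hc : barycenter {c} ∈ stdCell {c, b} \ {barycenter {b}} := by
    rw [stdCell_pair_diff hcb]
    exact ⟨(barycenter_mem_iff (by simp)).2 (by simp), barycenter_pos (by simp)⟩
  exact (convex_stdCell _).isPreconnected.union _
    ((barycenter_mem_iff (by simp)).2 (by simp)) hc (isPreconnected_stdCell_pair_diff hcb)

end Cells

namespace AbstractSimplicialComplex

variable {V : Type*} [Fintype V] [DecidableEq V] {X : AbstractSimplicialComplex V}

theorem mem_faces_of_subset {σ τ : Finset V} (hσ : σ ∈ X.faces) (h : τ ⊆ σ) (hτ : τ.Nonempty) :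
    τ ∈ X.faces := (X.isRelLowerSet_faces hσ).2 h hτ

theorem nonempty_of_mem_faces {σ : Finset V} (hσ : σ ∈ X.faces) : σ.Nonempty :=
  (X.isRelLowerSet_faces hσ).1

theorem mem_carrier_iff {x : V → ℝ} :
    x ∈ X.carrier ↔ x ∈ stdSimplex ℝ V ∧ coordSupport x ∈ X.faces := by
  constructor
  · rintro ⟨hx, σ, hσ, h⟩
    exact ⟨hx, mem_faces_of_subset hσ (mem_stdCell_iff.1 ⟨hx, h⟩).2 (coordSupport_nonempty hx)⟩
  · rintro ⟨hx, h⟩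
    exact ⟨hx, _, h, (mem_stdCell_iff.2 ⟨hx, Subset.rfl⟩).2⟩

theorem stdCell_subset_carrier {σ : Finset V} (hσ : σ ∈ X.faces) : stdCell σ ⊆ X.carrier :=
  fun _ hx => ⟨hx.1, σ, hσ, hx.2⟩

theorem IsTriangulatedTwoSphere.isPlaneCompactification (h : X.IsTriangulatedTwoSphere) :
    IsPlaneCompactification X.carrier :=
  h.elim IsPlaneCompactification.of_homeomorph

theorem IsTriangulatedTwoSphere.not_isPreconnected_diff_quadrilateral
    (h : X.IsTriangulatedTwoSphere) {a b c d : V} (hab : a ≠ b) (hac : a ≠ c) (had : a ≠ d)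
    (hbc : b ≠ c) (hbd : b ≠ d) (hcd : c ≠ d) (h1 : {a, c} ∈ X.faces) (h2 : {c, b} ∈ X.faces)
    (h3 : {a, d} ∈ X.faces) (h4 : {d, b} ∈ X.faces) :
    ¬ IsPreconnected (X.carrier \
      ((stdCell {a, c} ∪ stdCell {c, b}) ∪ (stdCell {a, d} ∪ stdCell {d, b}))) := by
  refine h.isPlaneCompactification.not_isPreconnected_diff
    ((isClosed_stdCell _).union (isClosed_stdCell _))
    ((isClosed_stdCell _).union (isClosed_stdCell _))
    (union_subset (stdCell_subset_carrier h1) (stdCell_subset_carrier h2))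
    (union_subset (stdCell_subset_carrier h3) (stdCell_subset_carrier h4))
    (p := barycenter {a}) (q := barycenter {b}) ?_ ?_
    (isPreconnected_union_stdCell_pair_diff hab hbc.symm)
    (isPreconnected_union_stdCell_pair_diff hab hbd.symm)
    (closure_mono (sdiff_subset_sdiff_left subset_union_right)
      (barycenter_mem_closure_stdCell_pair_diff hbc.symm))
    (closure_mono (sdiff_subset_sdiff_left subset_union_right)
      (barycenter_mem_closure_stdCell_pair_diff hbd.symm))
  · intro he
    have := barycenter_pos (Finset.mem_singleton_self a)
    rw [he, barycenter_eq_zero (by simpa using hab)] at this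
    exact this.false
  · have e1 : ({a, c} : Finset V) ∩ {a, d} = {a} := by grind
    have e2 : ({a, c} : Finset V) ∩ {d, b} = ∅ := by grind
    have e3 : ({c, b} : Finset V) ∩ {a, d} = ∅ := by grind
    have e4 : ({c, b} : Finset V) ∩ {d, b} = {b} := by grind
    have e5 : stdCell (∅ : Finset V) = ∅ := by
      ext x
      simp only [mem_empty_iff_false, iff_false]
      intro hx
      simpa using sum_of_mem_stdCell hx
    rw [inter_union_distrib_left, union_inter_distrib_right, union_inter_distrib_right]
    simp only [stdCell_inter, e1, e2, e3, e4, e5, stdCell_singleton]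
    ext x; simp [or_comm]

theorem IsTriangulatedTwoSphere.not_isPreconnected_diff_triangle
    (h : X.IsTriangulatedTwoSphere) {a b c : V} (hab : a ≠ b) (hac : a ≠ c)
    (hbc : b ≠ c) (h1 : {a, c} ∈ X.faces) (h2 : {c, b} ∈ X.faces) (h3 : {a, b} ∈ X.faces) :
    ¬ IsPreconnected (X.carrier \ ((stdCell {a, c} ∪ stdCell {c, b}) ∪ stdCell {a, b})) := by
  refine h.isPlaneCompactification.not_isPreconnected_diff
    ((isClosed_stdCell _).union (isClosed_stdCell _)) (isClosed_stdCell _)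
    (union_subset (stdCell_subset_carrier h1) (stdCell_subset_carrier h2))
    (stdCell_subset_carrier h3)
    (p := barycenter {a}) (q := barycenter {b}) ?_ ?_
    (isPreconnected_union_stdCell_pair_diff hab hbc.symm)
    (isPreconnected_stdCell_pair_diff hab)
    (closure_mono (sdiff_subset_sdiff_left subset_union_right)
      (barycenter_mem_closure_stdCell_pair_diff hbc.symm))
    (barycenter_mem_closure_stdCell_pair_diff hab)
  · intro he
    have := barycenter_pos (Finset.mem_singleton_self a)
    rw [he, barycenter_eq_zero (by simpa using hab)] at this
    exact this.false
  · have e1 : ({a, c} : Finset V) ∩ {a, b} = {a} := by grind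
    have e2 : ({c, b} : Finset V) ∩ {a, b} = {b} := by grind
    rw [union_inter_distrib_right]
    simp only [stdCell_inter, e1, e2, stdCell_singleton]
    ext x; simp [or_comm]

end AbstractSimplicialComplex

namespace AbstractSimplicialComplex

variable {V : Type*} [Fintype V] [DecidableEq V] {X : AbstractSimplicialComplex V}

theorem isCompact_carrier (X : AbstractSimplicialComplex V) : IsCompact X.carrier := by
  have : X.carrier = ⋃ σ ∈ X.faces, stdCell σ := by
    ext x
    simp only [carrier, stdCell, mem_ofPred_eq, mem_iUnion]
    exact ⟨fun ⟨h, σ, hσ, h'⟩ => ⟨σ, hσ, h, h'⟩, fun ⟨σ, hσ, h, h'⟩ => ⟨h, σ, hσ, h'⟩⟩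
  rw [this]
  exact (Set.toFinite X.faces).isCompact_biUnion fun σ _ => isCompact_stdCell σ

/-- Every edge of a triangulated `2`-sphere lies in at least two triangles. -/
theorem IsTriangulatedTwoSphere.exists_triangles (h : X.IsTriangulatedTwoSphere) {a b : V}
    (hab : a ≠ b) (he : {a, b} ∈ X.faces) :
    ∃ c d, c ≠ d ∧ c ≠ a ∧ c ≠ b ∧ d ≠ a ∧ d ≠ b ∧ {a, b, c} ∈ X.faces ∧ {a, b, d} ∈ X.faces := by
  by_contra hcon
  have huniq : ∀ c d, c ≠ a → c ≠ b → d ≠ a → d ≠ b → {a, b, c} ∈ X.faces →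
      {a, b, d} ∈ X.faces → c = d := by
    intro c d h1 h2 h3 h4 h5 h6
    by_contra hne
    exact hcon ⟨c, d, hne, h1, h2, h3, h4, h5, h6⟩
  have hmc : Continuous fun x : V → ℝ => min (x a) (x b) :=
    (continuous_apply a).min (continuous_apply b)
  set K : Set (V → ℝ) := {x ∈ X.carrier | min (x a) (x b) = 1 / 4} with hKdef
  have hKc : IsCompact K :=
    X.isCompact_carrier.inter_right (isClosed_eq hmc continuous_const)
  have hpos : ∀ x ∈ K, 0 < x a ∧ 0 < x b := fun x hx => by
    have := hx.2
    constructor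
    · linarith [min_le_left (x a) (x b)]
    · linarith [min_le_right (x a) (x b)]
  have hface : ∀ x ∈ K, ∀ e, e ≠ a → e ≠ b → x e ≠ 0 → {a, b, e} ∈ X.faces := by
    intro x hx e hea heb hxe
    refine mem_faces_of_subset (mem_carrier_iff.1 hx.1).2 ?_ (by simp)
    intro v hv
    rw [mem_coordSupport]
    simp only [Finset.mem_insert, Finset.mem_singleton] at hv
    rcases hv with rfl | rfl | rfl
    · exact (hpos x hx).1.ne'
    · exact (hpos x hx).2.ne'
    · exact hxe
  have hlog : LogProperty K := by
    by_cases hex : ∃ c, c ≠ a ∧ c ≠ b ∧ {a, b, c} ∈ X.faces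
    · obtain ⟨c, hca, hcb, hc⟩ := hex
      let p : V → ℝ := fun v => if v = a then 1 / 4 else if v = b then 1 / 4 else
        if v = c then 1 / 2 else 0
      have hpa : p a = 1 / 4 := by simp [p]
      have hpb : p b = 1 / 4 := by simp [p, hab.symm]
      have hpc : p c = 1 / 2 := by simp [p, hca, hcb]
      have hp0 : ∀ v, v ∉ ({a, b, c} : Finset V) → p v = 0 := fun v hv => by
        simp only [Finset.mem_insert, Finset.mem_singleton, not_or] at hv
        simp [p, hv.1, hv.2.1, hv.2.2]
      have hps : p ∈ stdCell {a, b, c} := by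
        refine ⟨⟨fun v => ?_, ?_⟩, hp0⟩
        · simp only [p]; split_ifs <;> norm_num
        · rw [← Finset.sum_subset (Finset.subset_univ {a, b, c}) fun v _ hv => hp0 v hv,
            Finset.sum_insert (by simp [hab, hca.symm]), Finset.sum_pair hcb.symm, hpa, hpb, hpc]
          norm_num
      refine LogProperty.of_starConvex (x₀ := p) hKc fun x hx s t hs ht hst => ?_
      have hxc : x ∈ stdCell {a, b, c} := by
        refine ⟨hx.1.1, fun v hv => ?_⟩
        simp only [Finset.mem_insert, Finset.mem_singleton, not_or] at hv
        by_contra hxv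
        exact hv.2.2 (huniq v c hv.1 hv.2.1 hca hcb (hface x hx v hv.1 hv.2.1 hxv) hc)
      refine ⟨stdCell_subset_carrier hc (convex_stdCell _ hps hxc hs ht hst), ?_⟩
      have hx2 := hx.2
      simp only [Pi.add_apply, Pi.smul_apply, smul_eq_mul, hpa, hpb]
      rw [min_add_add_left, ← mul_min_of_nonneg _ _ ht, hx2, ← add_mul, hst, one_mul]
    · apply LogProperty.of_finite
      have hsup : ∀ x ∈ K, x ∈ stdCell {a, b} := fun x hx => by
        refine ⟨hx.1.1, fun v hv => ?_⟩
        simp only [Finset.mem_insert, Finset.mem_singleton, not_or] at hv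
        by_contra hxv
        exact hex ⟨v, hv.1, hv.2, hface x hx v hv.1 hv.2 hxv⟩
      have hsum : ∀ x ∈ K, x a + x b = 1 := fun x hx => by
        have := sum_of_mem_stdCell (hsup x hx)
        rwa [Finset.sum_pair hab] at this
      refine Set.Finite.of_finite_image (f := fun x => x a)
        ((Set.toFinite {1 / 4, 3 / 4}).subset ?_) ?_
      · rintro _ ⟨x, hx, rfl⟩
        have h1 := hsum x hx
        have h2 := hx.2
        rcases min_choice (x a) (x b) with h3 | h3
        · left; simp only; linarith
        · right; simp only [mem_singleton_iff]; linarith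
      · intro x hx y hy hxy
        simp only at hxy
        funext v
        by_cases hva : v = a
        · rw [hva, hxy]
        by_cases hvb : v = b
        · rw [hvb]; linarith [hsum x hx, hsum y hy]
        · rw [(hsup x hx).2 v (by simp [hva, hvb]), (hsup y hy).2 v (by simp [hva, hvb])]
  have hconn := h.isPlaneCompactification.isPreconnected_diff hKc.isClosed (fun x hx => hx.1) hlog
  have hmeet := hconn {x | 1 / 4 < min (x a) (x b)} {x | min (x a) (x b) < 1 / 4}
    (isOpen_lt continuous_const hmc) (isOpen_lt hmc continuous_const)
    (fun x hx => (lt_or_gt_of_ne fun h' => hx.2 ⟨hx.1, h'⟩).symm)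
    ⟨barycenter {a, b}, ?_⟩ ⟨barycenter {a}, ?_⟩
  · obtain ⟨x, _, hx1, hx2⟩ := hmeet
    exact lt_asymm (show 1 / 4 < min (x a) (x b) from hx1) hx2
  · have h1 : (1 / 4 : ℝ) < min (barycenter {a, b} a) (barycenter {a, b} b) := by
      simp [barycenter, Finset.card_pair hab]; norm_num
    exact ⟨⟨stdCell_subset_carrier he (barycenter_mem (by simp)), fun h' => h1.ne' h'.2⟩, h1⟩
  · have h1 : min (barycenter {a} a) (barycenter {a} b) < 1 / 4 := by
      simp [barycenter, hab.symm]
    exact ⟨⟨stdCell_subset_carrier (X.singleton_mem a) (barycenter_mem (by simp)),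
      fun h' => h1.ne h'.2⟩, h1⟩

/-- A face containing an edge of a triangulated `2`-sphere is contained in one of any two
triangles at that edge. -/
theorem IsTriangulatedTwoSphere.subset_triangle (h : X.IsTriangulatedTwoSphere) {a b c d : V}
    (hab : a ≠ b) (hac : a ≠ c) (had : a ≠ d) (hbc : b ≠ c) (hbd : b ≠ d) (hcd : c ≠ d)
    (h1 : {a, b, c} ∈ X.faces) (h2 : {a, b, d} ∈ X.faces) {σ : Finset V} (hσ : σ ∈ X.faces)
    (ha : a ∈ σ) (hb : b ∈ σ) : σ ⊆ {a, b, c} ∨ σ ⊆ {a, b, d} := by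
  by_contra! hcon
  set C : Set (V → ℝ) := (stdCell {a, c} ∪ stdCell {c, b}) ∪ (stdCell {a, d} ∪ stdCell {d, b})
    with hC
  set D : Set (V → ℝ) := stdCell {a, b, c} ∪ stdCell {a, b, d} with hD
  set O : Set (V → ℝ) := {x ∈ stdCell {a, b, c} | 0 < x a ∧ 0 < x b} ∪
    {x ∈ stdCell {a, b, d} | 0 < x a ∧ 0 < x b} with hO
  set m := barycenter {a, b} with hm
  have hma : 0 < m a := barycenter_pos (by simp)
  have hmb : 0 < m b := barycenter_pos (by simp)
  have hmc : m ∈ stdCell {a, b, c} := (barycenter_mem_iff (by simp)).2 (by grind)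
  have hmd : m ∈ stdCell {a, b, d} := (barycenter_mem_iff (by simp)).2 (by grind)
  have hmO : m ∈ O := Or.inl ⟨hmc, hma, hmb⟩
  have hDS : D ⊆ X.carrier := union_subset (stdCell_subset_carrier h1) (stdCell_subset_carrier h2)
  have hCD : C ⊆ D := union_subset
    (union_subset ((stdCell_mono (by grind)).trans subset_union_left)
      ((stdCell_mono (by grind)).trans subset_union_left))
    (union_subset ((stdCell_mono (by grind)).trans subset_union_right)
      ((stdCell_mono (by grind)).trans subset_union_right))
  have hOC : ∀ x ∈ O, x ∈ X.carrier \ C := by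
    intro x hx
    have hp : 0 < x a ∧ 0 < x b := hx.elim (fun h => h.2) (fun h => h.2)
    refine ⟨hDS (hx.elim (fun h => Or.inl h.1) fun h => Or.inr h.1), ?_⟩
    rintro ((hc | hc) | (hc | hc))
    · exact hp.2.ne' (hc.2 b (by grind))
    · exact hp.1.ne' (hc.2 a (by grind))
    · exact hp.2.ne' (hc.2 b (by grind))
    · exact hp.1.ne' (hc.2 a (by grind))
  have hDO : ∀ x ∈ D, x ∈ O ∨ x ∈ C := by
    have key : ∀ e, a ≠ e → b ≠ e → ∀ x ∈ stdCell {a, b, e},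
        (0 < x a ∧ 0 < x b) ∨ x ∈ stdCell {a, e} ∪ stdCell {e, b} := by
      intro e hae hbe x hx
      rcases (nonneg_of_mem_stdCell hx a).eq_or_lt with h0 | h0
      · right; right
        exact stdCell_mono (by grind) (mem_stdCell_erase hx h0.symm)
      rcases (nonneg_of_mem_stdCell hx b).eq_or_lt with h0' | h0'
      · right; left
        exact stdCell_mono (by grind) (mem_stdCell_erase hx h0'.symm)
      exact Or.inl ⟨h0, h0'⟩
    rintro x (hx | hx)
    · exact (key c hac hbc x hx).imp (fun h => Or.inl ⟨hx, h⟩) (fun h => Or.inl h)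
    · exact (key d had hbd x hx).imp (fun h => Or.inr ⟨hx, h⟩) (fun h => Or.inr h)
  have hOconn : IsPreconnected O :=
    (convex_stdCell_pos_pos _ a b).isPreconnected.union m ⟨hmc, hma, hmb⟩ ⟨hmd, hma, hmb⟩
      (convex_stdCell_pos_pos _ a b).isPreconnected
  have hDconn : IsPreconnected (X.carrier \ D) :=
    h.isPlaneCompactification.isPreconnected_diff
      ((isClosed_stdCell _).union (isClosed_stdCell _)) hDS (logProperty_union_stdCell hmc hmd)
  have key : ∀ U W : Set (V → ℝ), IsOpen U → IsOpen W → X.carrier \ C ⊆ U ∪ W →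
      (X.carrier \ C) ∩ (U ∩ W) = ∅ → O ⊆ U → X.carrier \ C ⊆ U := by
    intro U W hU hW hUW hdisj hOU
    rcases isPreconnected_iff_subset_of_disjoint.1 hDconn U W hU hW
      ((sdiff_subset_sdiff_right hCD).trans hUW) (subset_empty_iff.1 (by
        rw [← hdisj]
        exact inter_subset_inter_left _ (sdiff_subset_sdiff_right hCD))) with hc | hc
    · intro x hx
      by_cases hxD : x ∈ D
      · exact hOU ((hDO x hxD).resolve_right hx.2)
      · exact hc ⟨hx.1, hxD⟩
    · exfalso
      have hσne : σ.Nonempty := ⟨a, ha⟩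
      have hmσ : m ∈ stdCell σ := (barycenter_mem_iff (by simp)).2 (by grind)
      obtain ⟨z, hzU, s, t, hs, ht, hst, rfl⟩ := mem_closure_iff.1
        (mem_closure_openSegment (barycenter σ) m) U hU (hOU hmO)
      have hzσ := convex_stdCell σ (barycenter_mem hσne) hmσ hs.le ht.le hst
      have hzD : s • barycenter σ + t • m ∉ D := by
        have hpos : ∀ v ∈ σ, (s • barycenter σ + t • m) v ≠ 0 := fun v hv => by
          have h1 := mul_pos hs (barycenter_pos hv)
          have h2 := mul_nonneg ht.le (nonneg_of_mem_stdCell hmσ v)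
          simp only [Pi.add_apply, Pi.smul_apply, smul_eq_mul]
          positivity
        rintro (hz | hz)
        · refine hcon.1 fun v hv => ?_
          by_contra hv'
          exact hpos v hv (hz.2 v hv')
        · refine hcon.2 fun v hv => ?_
          by_contra hv'
          exact hpos v hv (hz.2 v hv')
      have hzS := stdCell_subset_carrier hσ hzσ
      have : s • barycenter σ + t • m ∈ (∅ : Set (V → ℝ)) := by
        rw [← hdisj]
        exact ⟨⟨hzS, fun hz => hzD (hCD hz)⟩, hzU, hc ⟨hzS, hzD⟩⟩
      exact this
  refine h.not_isPreconnected_diff_quadrilateral hab hac had hbc hbd hcd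
    (mem_faces_of_subset h1 (by grind) (by simp)) (mem_faces_of_subset h1 (by grind) (by simp))
    (mem_faces_of_subset h2 (by grind) (by simp)) (mem_faces_of_subset h2 (by grind) (by simp)) ?_
  rw [isPreconnected_iff_subset_of_disjoint]
  intro U W hU hW hUW hdisj
  rcases isPreconnected_iff_subset_of_disjoint.1 hOconn U W hU hW (fun x hx => hUW (hOC x hx))
    (subset_empty_iff.1 (by
      rw [← hdisj]; exact inter_subset_inter_left _ hOC)) with hc | hc
  · exact Or.inl (key U W hU hW hUW hdisj hc)
  · exact Or.inr (key W U hW hU (by rwa [union_comm]) (by rwa [inter_comm W]) hc)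

/-- A `3`-cycle in a triangulated `2`-sphere separates the apexes of the two triangles at one of
its edges. -/
theorem IsTriangulatedTwoSphere.exists_separation (h : X.IsTriangulatedTwoSphere) {u v w c d : V}
    (huv : u ≠ v) (huw : u ≠ w) (hvw : v ≠ w) (huc : u ≠ c) (hvc : v ≠ c) (hwc : w ≠ c)
    (hud : u ≠ d) (hvd : v ≠ d) (hwd : w ≠ d) (hcd : c ≠ d)
    (h1 : {u, w} ∈ X.faces) (h2 : {w, v} ∈ X.faces)
    (hc : {u, v, c} ∈ X.faces) (hd : {u, v, d} ∈ X.faces) :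
    ∃ P : V → Prop, P c ∧ ¬ P d ∧ ∀ x y, x ∉ ({u, v, w} : Finset V) → y ∉ ({u, v, w} : Finset V) →
      {x, y} ∈ X.faces → (P x ↔ P y) := by
  have h3 : {u, v} ∈ X.faces := mem_faces_of_subset hc (by grind) (by simp)
  set α : Set (V → ℝ) := stdCell {u, w} ∪ stdCell {w, v} with hα
  set C : Set (V → ℝ) := α ∪ stdCell {u, v} with hC
  have hCsupp : ∀ x ∈ C, x ∈ stdCell {u, v, w} := by
    rintro x ((hx | hx) | hx) <;> exact stdCell_mono (by grind) hx
  have hQ : ∀ e, u ≠ e → v ≠ e → w ≠ e → {u, v, e} ∈ X.faces →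
      {x ∈ stdCell {u, v, e} | 0 < x e} ⊆ X.carrier \ C := by
    rintro e hue hve hwe he x ⟨hx, hxe⟩
    exact ⟨stdCell_subset_carrier he hx, fun hxC => hxe.ne' ((hCsupp x hxC).2 e (by grind))⟩
  have hver : ∀ e, u ≠ e → v ≠ e → w ≠ e → barycenter {e} ∈ X.carrier \ C := fun e h4 h5 h6 =>
    ⟨stdCell_subset_carrier (X.singleton_mem e) (barycenter_mem (by simp)), fun hxC =>
      (barycenter_pos (Finset.mem_singleton_self e)).ne' ((hCsupp _ hxC).2 e (by grind))⟩
  have hQe : ∀ e : V, barycenter {e} ∈ {x ∈ stdCell {u, v, e} | 0 < x e} := fun e =>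
    ⟨(barycenter_mem_iff (by simp)).2 (by simp), barycenter_pos (by simp)⟩
  have hw1 : barycenter {w} ∈ stdCell {u, w} := (barycenter_mem_iff (by simp)).2 (by simp)
  have hw2 : barycenter {w} ∈ stdCell {w, v} := (barycenter_mem_iff (by simp)).2 (by simp)
  have hαS : α ⊆ X.carrier := union_subset (stdCell_subset_carrier h1) (stdCell_subset_carrier h2)
  have hαconn := h.isPlaneCompactification.isPreconnected_diff
    ((isClosed_stdCell _).union (isClosed_stdCell _)) hαS (logProperty_union_stdCell hw1 hw2)
  have hnot := h.not_isPreconnected_diff_triangle huv huw hvw h1 h2 h3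
  simp only [isPreconnected_iff_subset_of_disjoint, not_forall, not_or] at hnot
  obtain ⟨U, W, hU, hW, hUW, hdisj, hnU, hnW⟩ := hnot
  have hsplit : ∀ T : Set (V → ℝ), IsPreconnected T → T ⊆ X.carrier \ C → T ⊆ U ∨ T ⊆ W :=
    fun T hT hTC => isPreconnected_iff_subset_of_disjoint.1 hT U W hU hW (hTC.trans hUW)
      (subset_empty_iff.1 (by rw [← hdisj]; exact inter_subset_inter_left _ hTC))
  have hnotboth : ∀ x ∈ X.carrier \ C, x ∈ U → x ∉ W := fun x hx hxU hxW => by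
    have : x ∈ (∅ : Set (V → ℝ)) := by rw [← hdisj]; exact ⟨hx, hxU, hxW⟩
    exact this
  have key : ∀ U W : Set (V → ℝ), IsOpen U → IsOpen W → X.carrier \ C ⊆ U ∪ W →
      (∀ x ∈ X.carrier \ C, x ∈ U → x ∉ W) → ¬ X.carrier \ C ⊆ U →
      {x ∈ stdCell {u, v, c} | 0 < x c} ⊆ U → {x ∈ stdCell {u, v, d} | 0 < x d} ⊆ U → False := by
    intro U W hU hW hUW hdisj hnU hQc hQd
    obtain ⟨y, hyC, hyU⟩ := not_subset.1 hnU
    have hyW : y ∈ W := (hUW hyC).resolve_left hyU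
    have hopen : IsOpen {x : V → ℝ | 0 < x u ∧ 0 < x v} :=
      (isOpen_lt continuous_const (continuous_apply u)).inter
        (isOpen_lt continuous_const (continuous_apply v))
    obtain ⟨z, hzα, hz1, hzW⟩ := hαconn (U ∪ {x : V → ℝ | 0 < x u ∧ 0 < x v}) W (hU.union hopen) hW
      (by
        intro x hx
        by_cases hxC : x ∈ C
        · have hxe : x ∈ stdCell {u, v} := hxC.resolve_left hx.2
          refine Or.inl (Or.inr ⟨(nonneg_of_mem_stdCell hxe u).lt_of_ne fun h0 => ?_,
            (nonneg_of_mem_stdCell hxe v).lt_of_ne fun h0 => ?_⟩)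
          · exact hx.2 (Or.inr (stdCell_mono (by grind) (mem_stdCell_erase hxe h0.symm)))
          · exact hx.2 (Or.inl (stdCell_mono (by grind) (mem_stdCell_erase hxe h0.symm)))
        · rcases hUW ⟨hx.1, hxC⟩ with hh | hh
          · exact Or.inl (Or.inl hh)
          · exact Or.inr hh)
      ⟨_, ⟨(hver c huc hvc hwc).1, fun hh => (hver c huc hvc hwc).2 (Or.inl hh)⟩,
        Or.inl (hQc (hQe c))⟩
      ⟨y, ⟨hyC.1, fun hh => hyC.2 (Or.inl hh)⟩, hyW⟩
    by_cases hzC : z ∈ C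
    · have hze : z ∈ stdCell {u, v} := hzC.resolve_left hzα.2
      obtain ⟨z', hz'W, s, t, hs, ht, hst, rfl⟩ := mem_closure_iff.1
        (mem_closure_openSegment (barycenter {c}) z) W hW hzW
      have hz'Q : s • barycenter {c} + t • z ∈ {x ∈ stdCell {u, v, c} | 0 < x c} := by
        refine ⟨convex_stdCell _ (hQe c).1 (stdCell_mono (by grind) hze) hs.le ht.le hst, ?_⟩
        have h4 := mul_pos hs (hQe c).2
        have h5 := mul_nonneg ht.le (nonneg_of_mem_stdCell hze c)
        simp only [Pi.add_apply, Pi.smul_apply, smul_eq_mul]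
        positivity
      exact hdisj _ (hQ c huc hvc hwc hc hz'Q) (hQc hz'Q) hz'W
    · have hzU : z ∉ U := fun hh => hdisj z ⟨hzα.1, hzC⟩ hh hzW
      have hzp : 0 < z u ∧ 0 < z v := hz1.resolve_left hzU
      obtain ⟨hzs, hzf⟩ := mem_carrier_iff.1 hzα.1
      have hfin : ∀ e, coordSupport z ⊆ {u, v, e} →
          {x ∈ stdCell {u, v, e} | 0 < x e} ⊆ U → False := by
        intro e hsub hQU
        have hze := mem_stdCell_iff.2 ⟨hzs, hsub⟩
        rcases (nonneg_of_mem_stdCell hze e).eq_or_lt with h0 | h0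
        · exact hzC (Or.inr (stdCell_mono (by grind) (mem_stdCell_erase hze h0.symm)))
        · exact hzU (hQU ⟨hze, h0⟩)
      rcases h.subset_triangle huv huc hud hvc hvd hcd hc hd hzf (mem_coordSupport.2 hzp.1.ne')
        (mem_coordSupport.2 hzp.2.ne') with hh | hh
      · exact hfin c hh hQc
      · exact hfin d hh hQd
  have hedge : ∀ x y, x ∉ ({u, v, w} : Finset V) → y ∉ ({u, v, w} : Finset V) →
      {x, y} ∈ X.faces → (barycenter {x} ∈ U ∧ barycenter {y} ∈ U) ∨
        (barycenter {x} ∈ W ∧ barycenter {y} ∈ W) := by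
    intro x y hx hy hxy
    have hxm : barycenter {x} ∈ stdCell {x, y} := (barycenter_mem_iff (by simp)).2 (by simp)
    have hym : barycenter {y} ∈ stdCell {x, y} := (barycenter_mem_iff (by simp)).2 (by simp)
    refine (hsplit (stdCell {x, y}) (convex_stdCell _).isPreconnected fun z hz =>
      ⟨stdCell_subset_carrier hxy hz, fun hzC => ?_⟩).imp (fun hh => ⟨hh hxm, hh hym⟩)
      (fun hh => ⟨hh hxm, hh hym⟩)
    have := (mem_stdCell_iff.1 hz).2
    have h4 := (mem_stdCell_iff.1 (hCsupp z hzC)).2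
    obtain ⟨e, he⟩ := coordSupport_nonempty hz.1
    have h5 := this he
    have h6 := h4 he
    simp only [Finset.mem_insert, Finset.mem_singleton] at h5
    rcases h5 with rfl | rfl
    · exact hx h6
    · exact hy h6
  have hvout : ∀ x, x ∉ ({u, v, w} : Finset V) → barycenter {x} ∈ X.carrier \ C := fun x hx =>
    hver x (by grind) (by grind) (by grind)
  rcases hsplit _ (convex_stdCell_pos _ c).isPreconnected (hQ c huc hvc hwc hc) with hcU | hcW <;>
    rcases hsplit _ (convex_stdCell_pos _ d).isPreconnected (hQ d hud hvd hwd hd) with hdU | hdW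
  · exact (key U W hU hW hUW hnotboth hnU hcU hdU).elim
  · refine ⟨fun x => barycenter {x} ∈ U, hcU (hQe c), fun hh =>
      hnotboth _ (hver d hud hvd hwd) hh (hdW (hQe d)), fun x y hx hy hxy => ?_⟩
    have h4 := hnotboth _ (hvout x hx)
    have h5 := hnotboth _ (hvout y hy)
    have h6 := hedge x y hx hy hxy
    tauto
  · refine ⟨fun x => barycenter {x} ∈ W, hcW (hQe c), fun hh =>
      hnotboth _ (hver d hud hvd hwd) (hdU (hQe d)) hh, fun x y hx hy hxy => ?_⟩
    have h4 := hnotboth _ (hvout x hx)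
    have h5 := hnotboth _ (hvout y hy)
    have h6 := hedge x y hx hy hxy
    tauto
  · exact (key W U hW hU (by rwa [union_comm]) (fun x hx h4 h5 => hnotboth x hx h5 h4) hnW
      hcW hdW).elim

/-- A family of faces of a triangulated `2`-sphere which is closed under passing to faces that
share an edge with a member contains all vertices. -/
theorem IsTriangulatedTwoSphere.mem_of_closed_family (h : X.IsTriangulatedTwoSphere)
    {T : Set (Finset V)} {W : Finset V} (hT : T ⊆ X.faces) (hTW : ∀ τ ∈ T, τ ⊆ W)
    (hne : ∃ τ ∈ T, 1 < τ.card)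
    (hcl : ∀ σ ∈ X.faces, ∀ τ ∈ T, ∀ p ∈ σ, ∀ q ∈ σ, p ≠ q → p ∈ τ → q ∈ τ → ∃ ρ ∈ T, σ ⊆ ρ)
    (x : V) : x ∈ W := by
  by_contra hxW
  set F : Set (V → ℝ) := (fun p => barycenter {p}) '' (W : Set V) with hF
  have hFfin : F.Finite := (W.finite_toSet).image _
  have hFS : F ⊆ X.carrier := by
    rintro _ ⟨p, _, rfl⟩
    exact stdCell_subset_carrier (X.singleton_mem p) (barycenter_mem (by simp))
  have hconn := h.isPlaneCompactification.isPreconnected_diff hFfin.isClosed hFS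
    (LogProperty.of_finite hFfin)
  rw [isPreconnected_closed_iff] at hconn
  obtain ⟨τ, hτ, hτc⟩ := hne
  have hτne : τ.Nonempty := nonempty_of_mem_faces (hT hτ)
  have hmeet := hconn (⋃ τ ∈ T, stdCell τ)
    (⋃ σ ∈ {σ ∈ X.faces | ¬ ∃ ρ ∈ T, σ ⊆ ρ}, stdCell σ)
    ((Set.toFinite _).isClosed_biUnion fun σ _ => isClosed_stdCell σ)
    ((Set.toFinite _).isClosed_biUnion fun σ _ => isClosed_stdCell σ) ?_ ?_ ?_
  · obtain ⟨z, hz, hz1, hz2⟩ := hmeet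
    obtain ⟨ρ, hρ, hzρ⟩ := mem_iUnion₂.1 hz1
    obtain ⟨σ, ⟨hσ, hσT⟩, hzσ⟩ := mem_iUnion₂.1 hz2
    have h1 := (mem_stdCell_iff.1 hzρ).2
    have h2 := (mem_stdCell_iff.1 hzσ).2
    obtain ⟨p, hp⟩ := coordSupport_nonempty hzρ.1
    have hsub : coordSupport z ⊆ {p} := fun q hq => by
      by_contra hqp
      exact hσT (hcl σ hσ ρ hρ p (h2 hp) q (h2 hq) (fun h' => hqp (by simp [h'])) (h1 hp) (h1 hq))
    exact hz.2 ⟨p, hTW ρ hρ (h1 hp),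
      (eq_barycenter_singleton (mem_stdCell_iff.2 ⟨hzρ.1, hsub⟩)).symm⟩
  · intro z hz
    obtain ⟨hzs, σ, hσ, hzσ⟩ := hz.1
    by_cases hσT : ∃ ρ ∈ T, σ ⊆ ρ
    · obtain ⟨ρ, hρ, hσρ⟩ := hσT
      exact Or.inl (mem_iUnion₂.2 ⟨ρ, hρ, stdCell_mono hσρ ⟨hzs, hzσ⟩⟩)
    · exact Or.inr (mem_iUnion₂.2 ⟨σ, ⟨hσ, hσT⟩, hzs, hzσ⟩)
  · refine ⟨barycenter τ, ⟨stdCell_subset_carrier (hT hτ) (barycenter_mem hτne), ?_⟩,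
      mem_iUnion₂.2 ⟨τ, hτ, barycenter_mem hτne⟩⟩
    rintro ⟨p, _, hp⟩
    have h1 : τ ⊆ {p} := by
      rw [← barycenter_mem_iff hτne, ← hp]
      exact barycenter_mem (by simp)
    have := Finset.card_le_card h1
    simp at this; omega
  · refine ⟨barycenter {x}, ⟨stdCell_subset_carrier (X.singleton_mem x) (barycenter_mem (by simp)),
      ?_⟩, mem_iUnion₂.2 ⟨{x}, ⟨X.singleton_mem x, ?_⟩, barycenter_mem (by simp)⟩⟩
    · rintro ⟨p, hpW, hp⟩
      have h1 : ({x} : Finset V) ⊆ {p} := by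
        rw [← barycenter_mem_iff (by simp), ← hp]
        exact barycenter_mem (by simp)
      simp at h1
      exact hxW (h1 ▸ hpW)
    · rintro ⟨ρ, hρ, hxρ⟩
      exact hxW (hTW ρ hρ (hxρ (by simp)))

end AbstractSimplicialComplex

section Bistellar

variable {V : Type*} [Fintype V] [DecidableEq V]

/-- The union of the closed faces of the standard simplex spanned by the members of `F`. -/
def faceUnion (F : Set (Finset V)) : Set (V → ℝ) :=
  {x | x ∈ stdSimplex ℝ V ∧ ∃ σ ∈ F, ∀ v, v ∉ σ → x v = 0}

/-- The conditions under which pushing the face `α` across the opposite face `β` maps the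
realization of `F` into that of `F'`. -/
structure BistellarStep (F F' : Set (Finset V)) (α β : Finset V) : Prop where
  down : ∀ σ ∈ F, ∀ τ ⊆ σ, τ.Nonempty → τ ∈ F
  not_subset : ∀ σ ∈ F, ¬ β ⊆ σ
  subset_union : ∀ σ ∈ F, α ⊆ σ → σ ⊆ α ∪ β
  mem_of_not_subset : ∀ σ ∈ F, ¬ α ⊆ σ → σ ∈ F'
  mem_of_subset : ∀ σ ⊆ α ∪ β, σ.Nonempty → ¬ α ⊆ σ → σ ∈ F'

/-- The piecewise linear map that pushes the face `α` across the face `β`. -/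
noncomputable def bistellarMap (α β : Finset V) (hα : α.Nonempty) (x : V → ℝ) : V → ℝ :=
  fun v => x v + α.inf' hα x * (if v ∈ β then (α.card : ℝ) / β.card else if v ∈ α then -1 else 0)

theorem continuous_bistellarMap (α β : Finset V) (hα : α.Nonempty) :
    Continuous (bistellarMap α β hα) := by
  refine continuous_pi fun v => (continuous_apply v).add (Continuous.mul ?_ continuous_const)
  exact Continuous.finset_inf'_apply hα fun i _ => continuous_apply i

theorem BistellarStep.mapsTo_and_leftInverse {F F' : Set (Finset V)} {α β : Finset V}
    (h : BistellarStep F F' α β) (hα : α.Nonempty) (hβ : β.Nonempty) (hd : Disjoint α β)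
    {x : V → ℝ} (hx : x ∈ faceUnion F) :
    bistellarMap α β hα x ∈ faceUnion F' ∧
      bistellarMap β α hβ (bistellarMap α β hα x) = x := by
  obtain ⟨hxs, σ, hσ, hxσ⟩ := hx
  have hαc : (0 : ℝ) < α.card := by exact_mod_cast hα.card_pos
  have hβc : (0 : ℝ) < β.card := by exact_mod_cast hβ.card_pos
  set m := α.inf' hα x with hm
  set y := bistellarMap α β hα x with hy
  have hm0 : 0 ≤ m := (Finset.le_inf'_iff hα _).2 fun v _ => hxs.1 v
  have hyβ : ∀ v ∈ β, y v = x v + m * (α.card / β.card) := fun v hv => by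
    simp [hy, bistellarMap, hv, hm]
  have hyα : ∀ v ∈ α, y v = x v - m := fun v hv => by
    have : v ∉ β := Finset.disjoint_left.1 hd hv
    simp [hy, bistellarMap, hv, hm, this]; ring
  have hyo : ∀ v, v ∉ α → v ∉ β → y v = x v := fun v h1 h2 => by
    simp [hy, bistellarMap, h1, h2]
  obtain ⟨a, ha, hma⟩ := α.exists_mem_eq_inf' hα x
  have hxβ : ∃ b ∈ β, x b = 0 := by
    have := h.not_subset σ hσ
    obtain ⟨b, hb, hbσ⟩ := Finset.not_subset.1 this
    exact ⟨b, hb, hxσ b hbσ⟩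
  have hyinf : β.inf' hβ y = m * (α.card / β.card) := by
    apply le_antisymm
    · obtain ⟨b, hb, hxb⟩ := hxβ
      refine (Finset.inf'_le _ hb).trans ?_
      rw [hyβ b hb, hxb, zero_add]
    · refine (Finset.le_inf'_iff hβ _).2 fun v hv => ?_
      rw [hyβ v hv]
      linarith [hxs.1 v]
  constructor
  · refine ⟨⟨fun v => ?_, ?_⟩, ?_⟩
    · by_cases hvβ : v ∈ β
      · rw [hyβ v hvβ]
        have := hxs.1 v
        positivity
      by_cases hvα : v ∈ α
      · rw [hyα v hvα]
        linarith [Finset.inf'_le x hvα]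
      · rw [hyo v hvα hvβ]; exact hxs.1 v
    · have h1 : ∀ v, y v = x v + m * ((if v ∈ β then (α.card : ℝ) / β.card else 0) +
          if v ∈ α then -1 else 0) := fun v => by
        by_cases hvβ : v ∈ β
        · have : v ∉ α := Finset.disjoint_right.1 hd hvβ
          simp [hyβ v hvβ, hvβ, this]
        · by_cases hvα : v ∈ α
          · simp [hyα v hvα, hvα, hvβ]; ring
          · simp [hyo v hvα hvβ, hvα, hvβ]
      simp only [h1, Finset.sum_add_distrib, ← Finset.mul_sum]
      rw [Finset.sum_ite_mem, Finset.sum_ite_mem, hxs.2]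
      simp
      right
      field_simp
      ring
    · rcases hm0.eq_or_lt with hm1 | hm1
      · have hyx : y = x := by
          funext v; simp [hy, bistellarMap, ← hm, ← hm1]
        rw [hyx]
        refine ⟨coordSupport x, h.mem_of_not_subset _ (h.down σ hσ _ ?_ ?_) ?_, ?_⟩
        · exact (mem_stdCell_iff.1 ⟨hxs, hxσ⟩).2
        · exact coordSupport_nonempty hxs
        · intro hsub
          exact mem_coordSupport.1 (hsub ha) (by rw [← hma, ← hm, ← hm1])
        · intro v hv
          by_contra hv'
          exact hv (mem_coordSupport.2 hv')
      · have hασ : α ⊆ σ := fun v hv => by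
          by_contra hvσ
          have := Finset.inf'_le x hv
          rw [hxσ v hvσ] at this
          linarith
        have hσu := h.subset_union σ hσ hασ
        refine ⟨(α ∪ β).erase a, h.mem_of_subset _ (Finset.erase_subset _ _) ?_ ?_, ?_⟩
        · obtain ⟨b, hb⟩ := hβ
          exact ⟨b, Finset.mem_erase.2 ⟨fun hba => Finset.disjoint_left.1 hd ha (hba ▸ hb),
            Finset.mem_union_right _ hb⟩⟩
        · exact fun hsub => by simpa using hsub ha
        · intro v hv
          by_cases hva : v = a
          · rw [hva, hyα a ha, ← hma, ← hm, sub_self]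
          · have hvu : v ∉ α ∪ β := fun h' => hv (Finset.mem_erase.2 ⟨hva, h'⟩)
            rw [Finset.mem_union, not_or] at hvu
            rw [hyo v hvu.1 hvu.2]
            exact hxσ v fun h' => by
              have := hσu h'
              rw [Finset.mem_union] at this
              tauto
  · funext v
    have : bistellarMap β α hβ y v = y v + m * (α.card / β.card) *
        (if v ∈ α then (β.card : ℝ) / α.card else if v ∈ β then -1 else 0) := by
      rw [← hyinf]; rfl
    rw [this]
    by_cases hvβ : v ∈ β
    · have : v ∉ α := Finset.disjoint_right.1 hd hvβ
      simp [hyβ v hvβ, hvβ, this]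
    by_cases hvα : v ∈ α
    · rw [hyα v hvα, if_pos hvα]
      field_simp
      ring
    · simp [hyo v hvα hvβ, hvα, hvβ]

/-- A bistellar move does not change the realization up to homeomorphism. -/
theorem BistellarStep.nonempty_homeomorph {F F' : Set (Finset V)} {α β : Finset V}
    (h : BistellarStep F F' α β) (h' : BistellarStep F' F β α) (hα : α.Nonempty) (hβ : β.Nonempty)
    (hd : Disjoint α β) : Nonempty (faceUnion F ≃ₜ faceUnion F') :=
  ⟨{ toFun := fun x => ⟨_, (h.mapsTo_and_leftInverse hα hβ hd x.2).1⟩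
     invFun := fun x => ⟨_, (h'.mapsTo_and_leftInverse hβ hα hd.symm x.2).1⟩
     left_inv := fun x => Subtype.ext (h.mapsTo_and_leftInverse hα hβ hd x.2).2
     right_inv := fun x => Subtype.ext (h'.mapsTo_and_leftInverse hβ hα hd.symm x.2).2
     continuous_toFun := Continuous.subtype_mk
       ((continuous_bistellarMap α β hα).comp continuous_subtype_val) _
     continuous_invFun := Continuous.subtype_mk
       ((continuous_bistellarMap β α hβ).comp continuous_subtype_val) _ }⟩

theorem isCompact_faceUnion (F : Set (Finset V)) : IsCompact (faceUnion F) := by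
  have : faceUnion F = ⋃ σ ∈ F, stdCell σ := by
    ext x
    simp only [faceUnion, stdCell, mem_ofPred_eq, mem_iUnion]
    exact ⟨fun ⟨h, σ, hσ, h'⟩ => ⟨σ, hσ, h, h'⟩, fun ⟨σ, hσ, h, h'⟩ => ⟨h, σ, hσ, h'⟩⟩
  rw [this]
  exact (Set.toFinite F).isCompact_biUnion fun σ _ => isCompact_stdCell σ

theorem mem_faceUnion_ssubset_iff {ι : Type*} [Fintype ι] {f : ι → V}
    (hf : Function.Injective f) {x : V → ℝ} :
    x ∈ faceUnion {σ : Finset V | σ.Nonempty ∧ σ ⊂ Finset.univ.image f} ↔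
      (∀ i, 0 ≤ x (f i)) ∧ ∑ i, x (f i) = 1 ∧ (∀ v, (∀ i, f i ≠ v) → x v = 0) ∧
        ∃ i, x (f i) = 0 := by
  have hsum : (∀ v, (∀ i, f i ≠ v) → x v = 0) → ∑ i, x (f i) = ∑ v, x v := fun h => by
    rw [← Finset.sum_image (f := x) fun i _ j _ hij => hf hij]
    exact Finset.sum_subset (Finset.subset_univ _) fun v _ hv => h v fun i hi => hv (by simp [← hi])
  constructor
  · rintro ⟨hx, σ, ⟨hne, hσ⟩, hxσ⟩
    have h0 : ∀ v, (∀ i, f i ≠ v) → x v = 0 := fun v hv => hxσ v fun hvσ => by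
      obtain ⟨i, _, hi⟩ := Finset.mem_image.1 (hσ.subset hvσ)
      exact hv i hi
    refine ⟨fun i => hx.1 _, (hsum h0).trans hx.2, h0, ?_⟩
    obtain ⟨v, hv, hvσ⟩ := Finset.exists_of_ssubset hσ
    obtain ⟨i, _, rfl⟩ := Finset.mem_image.1 hv
    exact ⟨i, hxσ _ hvσ⟩
  · rintro ⟨h1, h2, h3, i, hi⟩
    have hx : x ∈ stdSimplex ℝ V := by
      refine ⟨fun v => ?_, (hsum h3).symm.trans h2⟩
      by_cases hv : ∃ i, f i = v
      · obtain ⟨i, rfl⟩ := hv; exact h1 i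
      · exact (h3 v (not_exists.1 hv)).ge
    refine ⟨hx, coordSupport x, ⟨coordSupport_nonempty hx, ?_⟩, fun v hv => ?_⟩
    · rw [Finset.ssubset_iff_of_subset]
      · exact ⟨f i, by simp, fun h => mem_coordSupport.1 h hi⟩
      · intro v hv
        by_contra hv'
        refine mem_coordSupport.1 hv (h3 v fun i hi => hv' (by simp [← hi]))
    · by_contra h; exact hv (mem_coordSupport.2 h)

/-- The realization of the boundary of a tetrahedron is a `2`-sphere. -/
theorem nonempty_homeomorph_tetrahedron {f : Fin 4 → V} (hf : Function.Injective f) :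
    Nonempty (faceUnion {σ : Finset V | σ.Nonempty ∧ σ ⊂ Finset.univ.image f} ≃ₜ
      Metric.sphere (0 : EuclideanSpace ℝ (Fin 3)) 1) := by
  set S := faceUnion {σ : Finset V | σ.Nonempty ∧ σ ⊂ Finset.univ.image f} with hS
  have hcomp : CompactSpace S := isCompact_iff_compactSpace.1 (isCompact_faceUnion _)
  let L : (V → ℝ) → EuclideanSpace ℝ (Fin 3) := fun x =>
    WithLp.toLp 2 fun i => x (f i.castSucc) - x (f (Fin.last 3))
  have hLc : Continuous L := by fun_prop
  have hLi : ∀ x i, L x i = x (f (Fin.castSucc i)) - x (f (Fin.last 3)) := fun _ _ => rfl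
  have hL0 : ∀ x ∈ S, L x ≠ 0 := by
    intro x hx h0
    obtain ⟨h1, h2, h3, i, hi⟩ := (mem_faceUnion_ssubset_iff hf).1 hx
    have h4 : ∀ j, x (f j) = x (f (Fin.last 3)) := fun j => by
      induction j using Fin.lastCases with
      | last => rfl
      | cast j =>
        have := hLi x j
        rw [h0, PiLp.zero_apply] at this
        linarith
    have h5 : ∀ j, x (f j) = 0 := fun j => by rw [h4 j, ← h4 i, hi]
    simp [h5] at h2
  have hinj : ∀ x ∈ S, ∀ y ∈ S, ∀ t : ℝ, 0 < t → L x = t • L y → x = y := by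
    intro x hx y hy t ht hxy
    obtain ⟨h1, h2, h3, i, hi⟩ := (mem_faceUnion_ssubset_iff hf).1 hx
    obtain ⟨k1, k2, k3, j, hj⟩ := (mem_faceUnion_ssubset_iff hf).1 hy
    have h4 : ∀ j, x (f j) - x (f (Fin.last 3)) = t * (y (f j) - y (f (Fin.last 3))) := fun j => by
      induction j using Fin.lastCases with
      | last => simp
      | cast j =>
        rw [← hLi, hxy, ← hLi]; rfl
    have h5 : x (f (Fin.last 3)) = t * y (f (Fin.last 3)) := by
      have h6 := h4 i
      have h7 := h4 j
      have h8 := mul_nonneg ht.le (k1 i)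
      have h9 := h1 j
      rw [hi, mul_sub] at h6
      rw [hj, mul_sub] at h7
      linarith
    have h6 : ∀ j, x (f j) = t * y (f j) := fun j => by
      have := h4 j
      rw [mul_sub] at this; linarith
    have ht1 : t = 1 := by
      simp only [h6, ← Finset.mul_sum, k2] at h2
      linarith
    funext v
    by_cases hv : ∃ i, f i = v
    · obtain ⟨i, rfl⟩ := hv
      rw [h6, ht1, one_mul]
    · rw [h3 v (not_exists.1 hv), k3 v (not_exists.1 hv)]
  have hsurj : ∀ y : EuclideanSpace ℝ (Fin 3), ‖y‖ = 1 → ∃ x ∈ S, ∃ s : ℝ, 0 < s ∧ y = s • L x := by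
    intro y hy
    let z : Fin 4 → ℝ := Fin.snoc (α := fun _ => ℝ) (fun i => y i) 0
    have hzc : ∀ i, z (Fin.castSucc i) = y i := fun i => by simp [z]
    have hzl : z (Fin.last 3) = 0 := Fin.snoc_last (α := fun _ => ℝ) _ _
    obtain ⟨k, _, hk⟩ := Finset.univ.exists_mem_eq_inf' Finset.univ_nonempty z
    have hmin : ∀ i, z k ≤ z i := fun i => by
      rw [← hk]; exact Finset.inf'_le _ (Finset.mem_univ i)
    have hspos : 0 < ∑ i, (z i - z k) := by
      refine (Finset.sum_nonneg fun i _ => sub_nonneg.2 (hmin i)).lt_of_ne fun h0 => ?_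
      have h1 := (Finset.sum_eq_zero_iff_of_nonneg fun i _ => sub_nonneg.2 (hmin i)).1 h0.symm
      have h2 := h1 (Fin.last 3) (Finset.mem_univ _)
      have : y = 0 := by
        ext i
        have h3 := h1 i.castSucc (Finset.mem_univ _)
        rw [hzc] at h3
        rw [hzl] at h2
        simp; linarith
      rw [this] at hy; simp at hy
    set s := ∑ i, (z i - z k) with hs
    have hx : ∀ i, Function.extend f (fun i => (z i - z k) / s) 0 (f i) = (z i - z k) / s :=
      fun i => hf.extend_apply _ _ i
    refine ⟨Function.extend f (fun i => (z i - z k) / s) 0,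
      (mem_faceUnion_ssubset_iff hf).2 ⟨fun i => ?_, ?_, fun v hv => ?_, k, ?_⟩, s, hspos, ?_⟩
    · rw [hx]; exact div_nonneg (sub_nonneg.2 (hmin i)) hspos.le
    · simp only [hx]
      rw [← Finset.sum_div, ← hs, div_self hspos.ne']
    · exact Function.extend_apply' _ _ _ (by simpa using hv)
    · rw [hx]; simp
    · ext i
      rw [PiLp.smul_apply, hLi, hx, hx, hzc, hzl, smul_eq_mul]
      field_simp
      ring
  let Φ : S → Metric.sphere (0 : EuclideanSpace ℝ (Fin 3)) 1 := fun x =>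
    ⟨‖L x‖⁻¹ • L x, by
      have := norm_pos_iff.2 (hL0 x x.2)
      simp [norm_smul, this.ne']⟩
  have hΦ : Continuous Φ := by
    have hc : Continuous fun x : S => L x := hLc.comp continuous_subtype_val
    refine Continuous.subtype_mk (Continuous.smul (Continuous.inv₀ hc.norm fun x => ?_) hc) _
    exact norm_ne_zero_iff.2 (hL0 x x.2)
  have hbij : Function.Bijective Φ := by
    constructor
    · intro x y hxy
      have hx := norm_pos_iff.2 (hL0 x x.2)
      have hy := norm_pos_iff.2 (hL0 y y.2)
      refine Subtype.ext (hinj x x.2 y y.2 (‖L x‖ * ‖L y‖⁻¹) (by positivity) ?_)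
      have h1 : ‖L x‖⁻¹ • L x = ‖L y‖⁻¹ • L y := congrArg Subtype.val hxy
      rw [mul_smul, ← h1, smul_inv_smul₀ hx.ne']
    · intro y
      obtain ⟨x, hx, s, hs, hy⟩ := hsurj y (by simp)
      refine ⟨⟨x, hx⟩, Subtype.ext ?_⟩
      have h1 : ‖(y : EuclideanSpace ℝ (Fin 3))‖ = 1 := by simp
      rw [hy, norm_smul, Real.norm_of_nonneg hs.le] at h1
      change ‖L x‖⁻¹ • L x = y
      rw [hy]
      congr 1
      exact (eq_inv_of_mul_eq_one_left h1).symm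
  exact ⟨Continuous.homeoOfEquivCompactToT2 (f := Equiv.ofBijective Φ hbij) hΦ⟩

/-- There are triangulated `2`-spheres on each vertex set with at least four elements. -/
theorem exists_faceUnion_homeomorph_sphere (W : Finset V) (hW : 4 ≤ W.card) :
    ∃ F : Set (Finset V), (∀ σ ∈ F, σ.Nonempty ∧ σ ⊆ W ∧ ∀ τ ⊆ σ, τ.Nonempty → τ ∈ F) ∧
      (∀ v ∈ W, {v} ∈ F) ∧ (∃ α ∈ F, 1 < α.card ∧ ∀ σ ∈ F, α ⊆ σ → σ = α) ∧
      Nonempty (faceUnion F ≃ₜ Metric.sphere (0 : EuclideanSpace ℝ (Fin 3)) 1) := by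
  induction W using Finset.strongInduction with
  | H W ih =>
  rcases hW.eq_or_lt with h4 | h4
  · let e : Fin 4 ≃ W := (W.equivFinOfCardEq h4.symm).symm
    have hinj : Function.Injective (fun i => (e i : V)) :=
      Subtype.val_injective.comp e.injective
    have himg : Finset.univ.image (fun i => (e i : V)) = W := by
      refine Finset.eq_of_subset_of_card_le (fun v hv => ?_) ?_
      · obtain ⟨i, _, rfl⟩ := Finset.mem_image.1 hv
        exact (e i).2
      · rw [Finset.card_image_of_injective _ hinj]; simp [← h4]
    have hhom := nonempty_homeomorph_tetrahedron hinj
    rw [himg] at hhom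
    obtain ⟨a, ha⟩ : W.Nonempty := Finset.card_pos.1 (by omega)
    have hcard := Finset.card_erase_of_mem ha
    refine ⟨{σ | σ.Nonempty ∧ σ ⊂ W}, ?_, ?_, ⟨W.erase a, ⟨Finset.card_pos.1 (by omega), Finset.erase_ssubset ha⟩,
      by omega, ?_⟩, hhom⟩
    · exact fun σ hσ => ⟨hσ.1, hσ.2.subset, fun τ hτ hne => ⟨hne, hτ.trans_ssubset hσ.2⟩⟩
    · intro v hv
      refine ⟨by simp, (Finset.singleton_subset_iff.2 hv).ssubset_of_ne fun h => ?_⟩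
      rw [← h] at h4; simp at h4
    · intro σ hσ hsub
      have := Finset.card_lt_card hσ.2
      exact (Finset.eq_of_subset_of_card_le hsub (by omega)).symm
  · obtain ⟨o, ho⟩ : W.Nonempty := Finset.card_pos.1 (by omega)
    have hcard := Finset.card_erase_of_mem ho
    obtain ⟨F, hF, hFv, ⟨α, hα, hα1, hαmax⟩, ⟨e⟩⟩ :=
      ih (W.erase o) (Finset.erase_ssubset ho) (by omega)
    have hFo : ∀ σ ∈ F, o ∉ σ := fun σ hσ h => by simpa using (hF σ hσ).2.1 h
    have hαne : α.Nonempty := (hF α hα).1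
    let F' : Set (Finset V) := {σ | (σ ∈ F ∧ ¬ α ⊆ σ) ∨ (σ.Nonempty ∧ σ ⊆ α ∪ {o} ∧ ¬ α ⊆ σ)}
    have hF' : ∀ σ ∈ F', σ.Nonempty ∧ σ ⊆ W ∧ ∀ τ ⊆ σ, τ.Nonempty → τ ∈ F' := by
      rintro σ (⟨h1, h2⟩ | ⟨h1, h2, h3⟩)
      · exact ⟨(hF σ h1).1, (hF σ h1).2.1.trans (Finset.erase_subset _ _), fun τ hτ hne =>
          Or.inl ⟨(hF σ h1).2.2 τ hτ hne, fun h => h2 (h.trans hτ)⟩⟩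
      · refine ⟨h1, h2.trans (Finset.union_subset ((hF α hα).2.1.trans (Finset.erase_subset _ _))
          (by simpa using ho)), fun τ hτ hne =>
          Or.inr ⟨hne, hτ.trans h2, fun h => h3 (h.trans hτ)⟩⟩
    have hαo : o ∉ α := hFo α hα
    have hα2 : ∀ a ∈ α, ¬ α ⊆ {a, o} := by
      intro a ha h
      have : α ⊆ {a} := fun v hv => by
        have := h hv
        simp only [Finset.mem_insert, Finset.mem_singleton] at this ⊢
        rcases this with rfl | rfl
        · rfl
        · exact absurd hv hαo
      have := Finset.card_le_card this
      simp at this; omega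
    refine ⟨F', hF', ?_, ?_, ?_⟩
    · intro v hv
      by_cases hvo : v = o
      · subst hvo
        refine Or.inr ⟨by simp, by simp, fun h => ?_⟩
        have := Finset.card_le_card h
        simp at this; omega
      · refine Or.inl ⟨hFv v (Finset.mem_erase.2 ⟨hvo, hv⟩), fun h => ?_⟩
        have := Finset.card_le_card h
        simp at this; omega
    · obtain ⟨a, ha⟩ := hαne
      have hcα := Finset.card_erase_of_mem ha
      have hoe : o ∉ α.erase a := fun h => hαo (Finset.mem_of_mem_erase h)
      refine ⟨insert o (α.erase a), Or.inr ⟨by simp, by grind, by grind⟩, ?_, ?_⟩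
      · rw [Finset.card_insert_of_notMem hoe]; omega
      · rintro σ (⟨h1, h2⟩ | ⟨h1, h2, h3⟩) hsub
        · exact absurd (hsub (by simp)) (hFo σ h1)
        · refine Finset.Subset.antisymm (fun v hv => ?_) hsub
          have := h2 hv
          by_contra hv'
          have hva : v = a := by grind
          exact h3 fun b hb => by
            by_cases hba : b = a
            · rw [hba, ← hva]; exact hv
            · exact hsub (by simp [hba, hb])
    · have hstep : BistellarStep F F' α {o} := by
        refine ⟨fun σ hσ => (hF σ hσ).2.2, ?_, ?_, ?_, ?_⟩
        · intro σ hσ h; exact hFo σ hσ (h (by simp))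
        · intro σ hσ h; rw [hαmax σ hσ h]; exact Finset.subset_union_left
        · exact fun σ hσ h => Or.inl ⟨hσ, h⟩
        · exact fun σ hσ hne h => Or.inr ⟨hne, hσ, h⟩
      have hstep' : BistellarStep F' F {o} α := by
        refine ⟨fun σ hσ => (hF' σ hσ).2.2, ?_, ?_, ?_, ?_⟩
        · rintro σ (⟨h1, h2⟩ | ⟨h1, h2, h3⟩)
          · exact h2
          · exact h3
        · rintro σ (⟨h1, h2⟩ | ⟨h1, h2, h3⟩) h
          · exact absurd (h (by simp)) (hFo σ h1)
          · rwa [Finset.union_comm]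
        · rintro σ (⟨h1, h2⟩ | ⟨h1, h2, h3⟩) h
          · exact h1
          · refine (hF α hα).2.2 σ (fun v hv => ?_) h1
            have := h2 hv
            grind
        · intro σ h1 h2 h3
          refine (hF α hα).2.2 σ (fun v hv => ?_) h2
          have := h1 hv
          grind
      obtain ⟨e'⟩ := hstep.nonempty_homeomorph hstep' hαne (by simp)
        (Finset.disjoint_singleton_right.2 hαo)
      exact ⟨e'.symm.trans e⟩

end Bistellar

namespace SimpleGraph

section Components

variable {W : Type*} {G H : SimpleGraph W}

theorem Reachable.of_forall_adj (h : ∀ x y, G.Adj x y → H.Reachable x y) {x y : W}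
    (hxy : G.Reachable x y) : H.Reachable x y := by
  obtain ⟨p⟩ := hxy
  induction p with
  | nil => exact Reachable.refl _
  | cons hadj _ ih => exact (h _ _ hadj).trans ih

theorem not_reachable_of_forall_adj {P : W → Prop} (h : ∀ x y, G.Adj x y → P x → P y) {x y : W}
    (hx : P x) (hy : ¬ P y) : ¬ G.Reachable x y := by
  rintro ⟨p⟩
  induction p with
  | nil => exact hy hx
  | cons hadj _ ih => exact ih (h _ _ hadj hx) hy

variable [Finite W]

theorem card_connectedComponent_le (h : ∀ x y, G.Adj x y → H.Reachable x y) :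
    Nat.card H.ConnectedComponent ≤ Nat.card G.ConnectedComponent := by
  refine Nat.card_le_card_of_surjective (Quot.map id fun x y => Reachable.of_forall_adj h) ?_
  rintro ⟨x⟩
  exact ⟨Quot.mk _ x, rfl⟩

theorem card_connectedComponent_lt (h : ∀ x y, G.Adj x y → H.Reachable x y) {c d : W}
    (hH : H.Reachable c d) (hG : ¬ G.Reachable c d) :
    Nat.card H.ConnectedComponent < Nat.card G.ConnectedComponent := by
  refine (card_connectedComponent_le h).lt_of_ne fun he => hG ?_
  have hsurj : Function.Surjective (Quot.map id (fun x y => Reachable.of_forall_adj h) :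
      G.ConnectedComponent → H.ConnectedComponent) := by
    rintro ⟨x⟩
    exact ⟨Quot.mk _ x, rfl⟩
  have hinj := ((Nat.bijective_iff_surjective_and_card _).2 ⟨hsurj, he.symm⟩).1
  exact ConnectedComponent.exact (@hinj (G.connectedComponentMk c) (G.connectedComponentMk d)
    (ConnectedComponent.sound hH))

theorem card_connectedComponent_le_succ {a b : W}
    (h : ∀ x y, G.Adj x y → H.Adj x y ∨ (x = a ∧ y = b) ∨ (x = b ∧ y = a)) :
    Nat.card H.ConnectedComponent ≤ Nat.card G.ConnectedComponent + 1 := by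
  classical
  have key : ∀ x y, G.Reachable x y → ¬ H.Reachable x a → ¬ H.Reachable y a →
      H.Reachable x y := by
    suffices hs : ∀ x y, G.Reachable x y → H.Reachable x y ∨
        ((H.Reachable x a ∨ H.Reachable x b) ∧ (H.Reachable y a ∨ H.Reachable y b)) by
      intro x y hxy hx hy
      rcases hs x y hxy with h1 | ⟨h1, h2⟩
      · exact h1
      · exact (h1.resolve_left hx).trans (h2.resolve_left hy).symm
    rintro x y ⟨p⟩
    induction p with
    | nil => exact Or.inl (Reachable.refl _)
    | cons hadj _ ih =>
      rcases h _ _ hadj with h1 | ⟨rfl, rfl⟩ | ⟨rfl, rfl⟩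
      · rcases ih with h2 | ⟨h2, h3⟩
        · exact Or.inl (h1.reachable.trans h2)
        · exact Or.inr ⟨h2.imp h1.reachable.trans h1.reachable.trans, h3⟩
      · rcases ih with h2 | ⟨h2, h3⟩
        · exact Or.inr ⟨Or.inl (Reachable.refl _), Or.inr h2.symm⟩
        · exact Or.inr ⟨Or.inl (Reachable.refl _), h3⟩
      · rcases ih with h2 | ⟨h2, h3⟩
        · exact Or.inr ⟨Or.inr (Reachable.refl _), Or.inl h2.symm⟩
        · exact Or.inr ⟨Or.inr (Reachable.refl _), h3⟩
  rw [← Finite.card_option]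
  refine Nat.card_le_card_of_injective (fun C : H.ConnectedComponent =>
    if C = H.connectedComponentMk a then none else some (G.connectedComponentMk C.out)) ?_
  intro C D hCD
  have hout : ∀ C : H.ConnectedComponent, H.connectedComponentMk C.out = C := fun C => Quot.out_eq C
  simp only at hCD
  split_ifs at hCD with h1 h2 h2
  · rw [h1, h2]
  · rw [Option.some.injEq] at hCD
    rw [← hout C, ← hout D]
    rw [← hout C] at h1
    rw [← hout D] at h2
    exact ConnectedComponent.sound (key _ _ (ConnectedComponent.exact hCD)
      (fun h => h1 (ConnectedComponent.sound h)) (fun h => h2 (ConnectedComponent.sound h)))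

end Components

section Flip

variable {V : Type*} [Fintype V] [DecidableEq V] {G H : SimpleGraph V} {a b c d w : V}

/-- The number of connected components of the subgraph induced by `A`. -/
noncomputable def inducedComponents (G : SimpleGraph V) (A : Finset V) : ℕ :=
  Nat.card (G.induce (A : Set V)).ConnectedComponent

/-- Replacing the edge `ab` by `cd` preserves reachability in an induced subgraph in which `a` and
`b` have a common neighbour. -/
theorem induce_reachable_of_flip (hH : ∀ x y, H.Adj x y ↔
      (G.Adj x y ∧ s(x, y) ≠ s(a, b)) ∨ s(x, y) = s(c, d)) {A : Finset V}
    (hA : a ∈ A → b ∈ A → ∃ z ∈ A, G.Adj a z ∧ G.Adj z b) (x y : (A : Set V))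
    (hxy : (G.induce (A : Set V)).Adj x y) : (H.induce (A : Set V)).Reachable x y := by
  have hcom : ∀ (ha : a ∈ A) (hb : b ∈ A), (H.induce (A : Set V)).Reachable ⟨a, ha⟩ ⟨b, hb⟩ := by
    intro ha hb
    obtain ⟨z, hz, haz, hzb⟩ := hA ha hb
    have h1 : (H.induce (A : Set V)).Adj ⟨a, ha⟩ ⟨z, hz⟩ :=
      (hH a z).2 (Or.inl ⟨haz, by simpa using ⟨hzb.ne, fun _ => haz.ne'⟩⟩)
    have h2 : (H.induce (A : Set V)).Adj ⟨z, hz⟩ ⟨b, hb⟩ :=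
      (hH z b).2 (Or.inl ⟨hzb, by simpa using ⟨haz.ne', fun h => absurd h hzb.ne⟩⟩)
    exact h1.reachable.trans h2.reachable
  by_cases hs : s((x : V), (y : V)) = s(a, b)
  · rw [Sym2.eq_iff] at hs
    obtain ⟨x, hx⟩ := x
    obtain ⟨y, hy⟩ := y
    rcases hs with ⟨rfl, rfl⟩ | ⟨rfl, rfl⟩
    · exact hcom hx hy
    · exact (hcom hy hx).symm
  · have : (H.induce (A : Set V)).Adj x y := (hH _ _).2 (Or.inl ⟨hxy, hs⟩)
    exact this.reachable

theorem inducedComponents_le_of_flip (hH : ∀ x y, H.Adj x y ↔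
      (G.Adj x y ∧ s(x, y) ≠ s(a, b)) ∨ s(x, y) = s(c, d)) {A : Finset V}
    (hA : a ∈ A → b ∈ A → ∃ z ∈ A, G.Adj a z ∧ G.Adj z b) :
    H.inducedComponents A ≤ G.inducedComponents A :=
  card_connectedComponent_le (induce_reachable_of_flip hH hA)

theorem inducedComponents_le_succ_of_flip (hH : ∀ x y, H.Adj x y ↔
      (G.Adj x y ∧ s(x, y) ≠ s(a, b)) ∨ s(x, y) = s(c, d)) {A : Finset V}
    (ha : a ∈ A) (hb : b ∈ A) : H.inducedComponents A ≤ G.inducedComponents A + 1 := by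
  refine card_connectedComponent_le_succ (a := ⟨a, ha⟩) (b := ⟨b, hb⟩) fun x y hxy => ?_
  by_cases hs : s((x : V), (y : V)) = s(a, b)
  · rw [Sym2.eq_iff] at hs
    simp only [Subtype.ext_iff]
    exact Or.inr hs
  · exact Or.inl ((hH _ _).2 (Or.inl ⟨hxy, hs⟩))

theorem inducedComponents_lt_of_flip (hH : ∀ x y, H.Adj x y ↔
      (G.Adj x y ∧ s(x, y) ≠ s(a, b)) ∨ s(x, y) = s(c, d)) {A : Finset V}
    (ha : a ∉ A) (hc : c ∈ A) (hd : d ∈ A) {P : V → Prop} (hPc : P c) (hPd : ¬ P d)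
    (hP : ∀ x ∈ A, ∀ y ∈ A, G.Adj x y → P x → P y) :
    H.inducedComponents A < G.inducedComponents A := by
  refine card_connectedComponent_lt (c := ⟨c, hc⟩) (d := ⟨d, hd⟩)
    (induce_reachable_of_flip hH fun h => absurd h ha) ?_ ?_
  · have : (H.induce (A : Set V)).Adj ⟨c, hc⟩ ⟨d, hd⟩ := (hH c d).2 (Or.inr rfl)
    exact this.reachable
  · exact not_reachable_of_forall_adj (P := fun x : (A : Set V) => P x)
      (fun x y hxy => hP x x.2 y y.2 hxy) hPc hPd

theorem separationIndex_lt_of_equiv (π : Equiv.Perm V)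
    (hle : ∀ A, H.inducedComponents A + H.inducedComponents (π.finsetCongr A) ≤
      G.inducedComponents A + G.inducedComponents (π.finsetCongr A))
    (hlt : ∃ A, H.inducedComponents A + H.inducedComponents (π.finsetCongr A) <
      G.inducedComponents A + G.inducedComponents (π.finsetCongr A)) :
    H.separationIndex < G.separationIndex := by
  have key : ∀ K : SimpleGraph V, 2 * K.separationIndex = ∑ A : Finset V,
      (((K.inducedComponents A + K.inducedComponents (π.finsetCongr A) : ℕ) : ℚ) - 2) /
        ((Fintype.card V).choose A.card : ℚ) := by
    intro K
    have h1 : K.separationIndex = ∑ A : Finset V, ((K.inducedComponents A : ℚ) - 1) /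
      ((Fintype.card V).choose A.card : ℚ) := rfl
    have h2 : K.separationIndex = ∑ A : Finset V,
        ((K.inducedComponents (π.finsetCongr A) : ℚ) - 1) /
        ((Fintype.card V).choose A.card : ℚ) := by
      rw [h1, ← Equiv.sum_comp π.finsetCongr]
      refine Finset.sum_congr rfl fun A _ => ?_
      rw [Equiv.finsetCongr_apply, Finset.card_map]
    rw [two_mul]
    nth_rewrite 1 [h1]
    rw [h2, ← Finset.sum_add_distrib]
    refine Finset.sum_congr rfl fun A _ => ?_
    push_cast
    ring
  have hpos : ∀ A : Finset V, (0 : ℚ) < ((Fintype.card V).choose A.card : ℚ) := fun A => by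
    exact_mod_cast Nat.choose_pos (Finset.card_le_univ A)
  suffices h : 2 * H.separationIndex < 2 * G.separationIndex by linarith
  rw [key, key]
  obtain ⟨A, hA⟩ := hlt
  refine Finset.sum_lt_sum (fun A _ => ?_) ⟨A, Finset.mem_univ A, ?_⟩
  · refine div_le_div_of_nonneg_right (sub_le_sub_right ?_ _) (hpos A).le
    exact_mod_cast hle A
  · refine div_lt_div_of_pos_right (sub_lt_sub_right ?_ _) (hpos A)
    exact_mod_cast hA

/-- If the edge `ab` of the `3`-cycle `abw` is replaced by an edge `cd` between the two sides of
the cycle, then the separation index decreases, unless `c` and `d` are adjacent to `w` and the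
common neighbours of `a` and `b` are `w`, `c` and `d`. -/
theorem separationIndex_lt_of_flip (hH : ∀ x y, H.Adj x y ↔
      (G.Adj x y ∧ s(x, y) ≠ s(a, b)) ∨ s(x, y) = s(c, d))
    (hac : G.Adj a c) (had : G.Adj a d) (hbc : G.Adj b c) (hbd : G.Adj b d) (haw : G.Adj a w)
    (hbw : G.Adj b w) (hab : a ≠ b) (hcd : c ≠ d) (hcw : c ≠ w) (hdw : d ≠ w)
    {P : V → Prop} (hPc : P c) (hPd : ¬ P d)
    (hP : ∀ x y, x ∉ ({a, b, w} : Finset V) → y ∉ ({a, b, w} : Finset V) → G.Adj x y → P x → P y)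
    (hlt : ¬ (G.Adj w c ∧ G.Adj w d) ∨
      ∃ z, z ≠ w ∧ z ≠ c ∧ z ≠ d ∧ G.Adj a z ∧ G.Adj b z) :
    H.separationIndex < G.separationIndex := by
  have hncd : ¬ G.Adj c d := fun h => hPd (hP c d
    (by simp [hac.ne', hbc.ne', hcw]) (by simp [had.ne', hbd.ne', hdw]) h hPc)
  set π : Equiv.Perm V := Equiv.swap a c * Equiv.swap b d with hπ
  have hne1 := hac.ne
  have hne2 := had.ne
  have hne3 := hbc.ne
  have hne4 := hbd.ne
  have hne5 := haw.ne
  have hne6 := hbw.ne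
  have πa : π a = c := by
    simp [hπ, Equiv.swap_apply_of_ne_of_ne hab hne2]
  have πb : π b = d := by
    simp [hπ, Equiv.swap_apply_of_ne_of_ne hne2.symm hcd.symm]
  have πc : π c = a := by
    simp [hπ, Equiv.swap_apply_of_ne_of_ne hne3.symm hcd]
  have πd : π d = b := by
    simp [hπ, Equiv.swap_apply_of_ne_of_ne hab.symm hne3]
  have πo : ∀ z, z ≠ a → z ≠ b → z ≠ c → z ≠ d → π z = z := fun z h1 h2 h3 h4 => by
    simp [hπ, Equiv.swap_apply_of_ne_of_ne h2 h4, Equiv.swap_apply_of_ne_of_ne h1 h3]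
  have πw := πo w hne5.symm hne6.symm hcw.symm hdw.symm
  have hmem : ∀ (A : Finset V) z, π z ∈ π.finsetCongr A ↔ z ∈ A := fun A z => by
    rw [Equiv.finsetCongr_apply]; simp
  have ma : ∀ A : Finset V, c ∈ π.finsetCongr A ↔ a ∈ A := fun A => by rw [← hmem A a, πa]
  have mb : ∀ A : Finset V, d ∈ π.finsetCongr A ↔ b ∈ A := fun A => by rw [← hmem A b, πb]
  have mc : ∀ A : Finset V, a ∈ π.finsetCongr A ↔ c ∈ A := fun A => by rw [← hmem A c, πc]
  have md : ∀ A : Finset V, b ∈ π.finsetCongr A ↔ d ∈ A := fun A => by rw [← hmem A d, πd]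
  have mw : ∀ A : Finset V, w ∈ π.finsetCongr A ↔ w ∈ A := fun A => by
    conv_lhs => rw [← πw]
    exact hmem A w
  have hsep : ∀ A : Finset V, c ∈ A → d ∈ A → a ∉ A → b ∉ A → w ∉ A →
      H.inducedComponents A < G.inducedComponents A := fun A h1 h2 h3 h4 h5 =>
    have hout : ∀ x ∈ A, x ∉ ({a, b, w} : Finset V) := by
      rintro x hx hx'
      simp only [Finset.mem_insert, Finset.mem_singleton] at hx'
      rcases hx' with rfl | rfl | rfl <;> contradiction
    inducedComponents_lt_of_flip hH h3 h1 h2 hPc hPd fun x hx y hy => hP x y (hout x hx) (hout y hy)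
  have hle : ∀ A : Finset V, ¬ (a ∈ A ∧ b ∈ A ∧ c ∉ A ∧ d ∉ A ∧ w ∉ A) →
      H.inducedComponents A ≤ G.inducedComponents A := by
    intro A hA
    refine inducedComponents_le_of_flip hH fun h1 h2 => ?_
    by_cases h3 : c ∈ A
    · exact ⟨c, h3, hac, hbc.symm⟩
    by_cases h4 : d ∈ A
    · exact ⟨d, h4, had, hbd.symm⟩
    by_cases h5 : w ∈ A
    · exact ⟨w, h5, haw, hbw.symm⟩
    exact (hA ⟨h1, h2, h3, h4, h5⟩).elim
  refine separationIndex_lt_of_equiv π (fun A => ?_) ?_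
  · by_cases hA : a ∈ A ∧ b ∈ A ∧ c ∉ A ∧ d ∉ A ∧ w ∉ A
    · have h1 := inducedComponents_le_succ_of_flip hH hA.1 hA.2.1
      have h2 := hsep (π.finsetCongr A) ((ma A).2 hA.1) ((mb A).2 hA.2.1)
        (by rw [mc]; exact hA.2.2.1) (by rw [md]; exact hA.2.2.2.1) (by rw [mw]; exact hA.2.2.2.2)
      omega
    have hA1 := hle A hA
    by_cases hA' : c ∈ A ∧ d ∈ A ∧ a ∉ A ∧ b ∉ A ∧ w ∉ A
    · have h1 := inducedComponents_le_succ_of_flip hH ((mc A).2 hA'.1) ((md A).2 hA'.2.1)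
      have h2 := hsep A hA'.1 hA'.2.1 hA'.2.2.1 hA'.2.2.2.1 hA'.2.2.2.2
      omega
    · have := hle (π.finsetCongr A) (by rwa [ma, mb, mc, md, mw])
      omega
  · rcases hlt with hlt | ⟨z, hzw, hzc, hzd, haz, hbz⟩
    · refine ⟨{w, c, d}, ?_⟩
      have h1 := hle (π.finsetCongr {w, c, d}) (by rw [mw]; simp)
      have h2 : H.inducedComponents {w, c, d} < G.inducedComponents {w, c, d} := by
        by_cases hwc : G.Adj w c
        · have hwd : ¬ G.Adj w d := fun h => hlt ⟨hwc, h⟩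
          refine inducedComponents_lt_of_flip hH (by simp [hne1, hne2, hne5]) (by simp) (by simp)
            (P := fun x => x ≠ d) hcd (by simp) ?_
          rintro x hx y hy hxy hxd rfl
          simp only [Finset.mem_insert, Finset.mem_singleton] at hx
          rcases hx with rfl | rfl | rfl
          · exact hwd hxy
          · exact hncd hxy
          · exact hxd rfl
        · refine inducedComponents_lt_of_flip hH (by simp [hne1, hne2, hne5]) (by simp) (by simp)
            (P := fun x => x = c) rfl hcd.symm ?_
          rintro x hx y hy hxy rfl
          simp only [Finset.mem_insert, Finset.mem_singleton] at hy
          rcases hy with rfl | rfl | rfl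
          · exact (hwc hxy.symm).elim
          · rfl
          · exact (hncd hxy).elim
      omega
    · refine ⟨{a, b, z}, ?_⟩
      have h1 : H.inducedComponents {a, b, z} ≤ G.inducedComponents {a, b, z} :=
        inducedComponents_le_of_flip hH fun _ _ => ⟨z, by simp, haz, hbz.symm⟩
      have h2 := hsep (π.finsetCongr {a, b, z}) ((ma _).2 (by simp)) ((mb _).2 (by simp))
        (by rw [mc]; simp [hne1.symm, hne3.symm, hzc.symm])
        (by rw [md]; simp [hne2.symm, hne4.symm, hzd.symm])
        (by rw [mw]; simp [hne5.symm, hne6.symm, hzw.symm])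
      omega

end Flip

end SimpleGraph

namespace AbstractSimplicialComplex

variable {V : Type*} [Fintype V] [DecidableEq V] {X : AbstractSimplicialComplex V}

theorem pair_subset_pair_iff {a b x y : V} (hab : a ≠ b) :
    ({a, b} : Finset V) ⊆ {x, y} ↔ s(x, y) = s(a, b) := by
  rw [Sym2.eq_iff]
  constructor
  · intro h
    have h1 : a ∈ ({x, y} : Finset V) := h (by simp)
    have h2 : b ∈ ({x, y} : Finset V) := h (by simp)
    simp only [Finset.mem_insert, Finset.mem_singleton] at h1 h2
    rcases h1 with rfl | rfl <;> rcases h2 with rfl | rfl <;> simp_all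
  · rintro (⟨rfl, rfl⟩ | ⟨rfl, rfl⟩)
    · rfl
    · rw [Finset.pair_comm]

/-- The edge flip replacing `ab` by `cd` yields a triangulated `2`-sphere. -/
theorem IsTriangulatedTwoSphere.exists_flip (h : X.IsTriangulatedTwoSphere) {a b c d : V}
    (hab : a ≠ b) (hac : a ≠ c) (had : a ≠ d) (hbc : b ≠ c) (hbd : b ≠ d) (hcd : c ≠ d)
    (hc : {a, b, c} ∈ X.faces) (hd : {a, b, d} ∈ X.faces) (hn : {c, d} ∉ X.faces) :
    ∃ Y : AbstractSimplicialComplex V, Y.IsTriangulatedTwoSphere ∧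
      ∀ x y, Y.oneSkeleton.Adj x y ↔
        (X.oneSkeleton.Adj x y ∧ s(x, y) ≠ s(a, b)) ∨ s(x, y) = s(c, d) := by
  let F : Set (Finset V) := {σ | (σ ∈ X.faces ∧ ¬ {a, b} ⊆ σ) ∨
    (σ.Nonempty ∧ σ ⊆ {a, b} ∪ {c, d} ∧ ¬ {a, b} ⊆ σ)}
  have hF : ∀ σ ∈ F, σ.Nonempty ∧ ∀ τ ⊆ σ, τ.Nonempty → τ ∈ F := by
    rintro σ (⟨h1, h2⟩ | ⟨h1, h2, h3⟩)
    · exact ⟨nonempty_of_mem_faces h1, fun τ hτ hne =>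
        Or.inl ⟨mem_faces_of_subset h1 hτ hne, fun h => h2 (h.trans hτ)⟩⟩
    · exact ⟨h1, fun τ hτ hne => Or.inr ⟨hne, hτ.trans h2, fun h => h3 (h.trans hτ)⟩⟩
  let Y : AbstractSimplicialComplex V :=
    { faces := F
      isRelLowerSet_faces := fun {σ} hσ => ⟨(hF σ hσ).1, fun τ hτ hne => (hF σ hσ).2 τ hτ hne⟩
      singleton_mem := fun v => Or.inl ⟨X.singleton_mem v, fun hs => by
        have := Finset.card_le_card hs
        rw [Finset.card_pair hab] at this
        simp at this⟩ }
  have hnot : ∀ σ ∈ X.faces, ¬ {c, d} ⊆ σ := fun σ hσ hs =>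
    hn (mem_faces_of_subset hσ hs (by simp))
  have hmem : ∀ σ : Finset V, σ ⊆ {a, b} ∪ {c, d} → σ.Nonempty → ¬ {c, d} ⊆ σ → σ ∈ X.faces := by
    intro σ h1 h2 h3
    have h4 : σ ⊆ {a, b, c} ∨ σ ⊆ {a, b, d} := by
      by_cases hcσ : c ∈ σ
      · have hdσ : d ∉ σ := fun hdσ => h3 (by
          intro v hv; simp only [Finset.mem_insert, Finset.mem_singleton] at hv
          rcases hv with rfl | rfl <;> assumption)
        left; intro v hv
        have := h1 hv
        simp only [Finset.mem_union, Finset.mem_insert, Finset.mem_singleton] at this ⊢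
        rcases this with (rfl | rfl) | (rfl | rfl) <;> simp_all
      · right; intro v hv
        have := h1 hv
        simp only [Finset.mem_union, Finset.mem_insert, Finset.mem_singleton] at this ⊢
        rcases this with (rfl | rfl) | (rfl | rfl) <;> simp_all
    rcases h4 with h4 | h4
    · exact mem_faces_of_subset hc h4 h2
    · exact mem_faces_of_subset hd h4 h2
  have hstep : BistellarStep X.faces F {a, b} {c, d} := by
    refine ⟨fun σ hσ τ hτ hne => mem_faces_of_subset hσ hτ hne, hnot, fun σ hσ hs => ?_,
      fun σ hσ hs => Or.inl ⟨hσ, hs⟩, fun σ hσ hne hs => Or.inr ⟨hne, hσ, hs⟩⟩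
    rcases h.subset_triangle hab hac had hbc hbd hcd hc hd hσ (hs (by simp)) (hs (by simp))
      with hh | hh
    · exact hh.trans (by intro v hv; simp at hv ⊢; tauto)
    · exact hh.trans (by intro v hv; simp at hv ⊢; tauto)
  have hstep' : BistellarStep F X.faces {c, d} {a, b} := by
    refine ⟨fun σ hσ => (hF σ hσ).2, ?_, ?_, ?_, fun σ hσ => hmem σ (by rwa [Finset.union_comm])⟩
    · rintro σ (⟨h1, h2⟩ | ⟨h1, h2, h3⟩) <;> assumption
    · rintro σ (⟨h1, h2⟩ | ⟨h1, h2, h3⟩) hs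
      · exact absurd hs (hnot σ h1)
      · rwa [Finset.union_comm]
    · rintro σ (⟨h1, h2⟩ | ⟨h1, h2, h3⟩) hs
      · exact h1
      · exact hmem σ h2 h1 hs
  obtain ⟨e⟩ := hstep.nonempty_homeomorph hstep' (by simp) (by simp)
    (by simp [hac.symm, had.symm, hbc.symm, hbd.symm])
  refine ⟨Y, h.elim fun e' => ⟨Homeomorph.trans e.symm e'⟩, fun x y => ?_⟩
  have hYX : Y.oneSkeleton.Adj x y ↔ x ≠ y ∧ (({x, y} ∈ X.faces ∧ ¬ {a, b} ⊆ ({x, y} : Finset V)) ∨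
    (({x, y} : Finset V).Nonempty ∧ ({x, y} : Finset V) ⊆ {a, b} ∪ {c, d} ∧
      ¬ {a, b} ⊆ ({x, y} : Finset V))) := Iff.rfl
  have hX : X.oneSkeleton.Adj x y ↔ x ≠ y ∧ {x, y} ∈ X.faces := Iff.rfl
  rw [hYX, hX, pair_subset_pair_iff hab]
  constructor
  · rintro ⟨hxy, ⟨h1, h2⟩ | ⟨h1, h2, h3⟩⟩
    · exact Or.inl ⟨⟨hxy, h1⟩, h2⟩
    · by_cases hs : s(x, y) = s(c, d)
      · exact Or.inr hs
      · rw [← pair_subset_pair_iff hcd] at hs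
        exact Or.inl ⟨⟨hxy, hmem _ h2 h1 hs⟩, h3⟩
  · rintro (⟨⟨hxy, h1⟩, h2⟩ | hs)
    · exact ⟨hxy, Or.inl ⟨h1, h2⟩⟩
    · have h1 : ({x, y} : Finset V) = {c, d} := by
        rw [Sym2.eq_iff] at hs
        rcases hs with ⟨rfl, rfl⟩ | ⟨rfl, rfl⟩
        · rfl
        · exact Finset.pair_comm _ _
      refine ⟨fun hxy => ?_, Or.inr ⟨by simp, ?_, ?_⟩⟩
      · subst hxy
        rw [Sym2.eq_iff] at hs
        rcases hs with ⟨rfl, rfl⟩ | ⟨rfl, rfl⟩ <;> exact hcd rfl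
      · rw [h1]; exact Finset.subset_union_right
      · rw [hs, Sym2.eq_iff]
        rintro (⟨rfl, _⟩ | ⟨rfl, _⟩)
        · exact hac rfl
        · exact hbc rfl

/-- In a sphere of minimum separation index, the apexes of the triangles at an edge `uv` of an
induced `3`-cycle `uvw` are adjacent to `w`, and `u` and `v` have no further common neighbours. -/
theorem IsMinimumTwoSphere.adj_apex (h : X.IsMinimumTwoSphere) {u v w : V}
    (huvw : X.IsInducedThreeCycle u v w) :
    ∃ c d, c ≠ d ∧ {u, v, c} ∈ X.faces ∧ {u, v, d} ∈ X.faces ∧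
      (X.oneSkeleton.Adj u c ∧ X.oneSkeleton.Adj v c ∧ X.oneSkeleton.Adj w c) ∧
      (X.oneSkeleton.Adj u d ∧ X.oneSkeleton.Adj v d ∧ X.oneSkeleton.Adj w d) ∧
      ∀ z, X.oneSkeleton.Adj u z → X.oneSkeleton.Adj v z → z = w ∨ z = c ∨ z = d := by
  obtain ⟨huv, hvw, huw, hnf⟩ := huvw
  obtain ⟨c, d, hcd, hcu, hcv, hdu, hdv, hc, hd⟩ := h.1.exists_triangles huv.1 huv.2
  have hcw : c ≠ w := fun he => hnf (he ▸ hc)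
  have hdw : d ≠ w := fun he => hnf (he ▸ hd)
  have hwv : {w, v} ∈ X.faces := hvw.symm.2
  obtain ⟨P, hPc, hPd, hP⟩ := h.1.exists_separation huv.1 huw.1 hvw.1 hcu.symm hcv.symm hcw.symm
    hdu.symm hdv.symm hdw.symm hcd huw.2 hwv hc hd
  have hadj : ∀ e, e ≠ u → e ≠ v → {u, v, e} ∈ X.faces →
      X.oneSkeleton.Adj u e ∧ X.oneSkeleton.Adj v e := fun e h1 h2 h3 =>
    ⟨⟨h1.symm, mem_faces_of_subset h3 (by intro x; simp; tauto) (by simp)⟩,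
      ⟨h2.symm, mem_faces_of_subset h3 (by intro x; simp; tauto) (by simp)⟩⟩
  have hn : {c, d} ∉ X.faces := fun hf => hPd ((hP c d (by simp [hcu, hcv, hcw])
    (by simp [hdu, hdv, hdw]) hf).1 hPc)
  obtain ⟨Y, hY, hYX⟩ := h.1.exists_flip huv.1 hcu.symm hdu.symm hcv.symm hdv.symm hcd hc hd hn
  have hmin : ¬ Y.oneSkeleton.separationIndex < X.oneSkeleton.separationIndex :=
    not_lt.2 (h.2 Y hY)
  have key := mt (fun hlt => SimpleGraph.separationIndex_lt_of_flip (w := w) hYX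
    (hadj c hcu hcv hc).1 (hadj d hdu hdv hd).1 (hadj c hcu hcv hc).2 (hadj d hdu hdv hd).2
    huw hvw huv.1 hcd hcw hdw hPc hPd
    (fun x y hx hy hxy => (hP x y hx hy hxy.2).1) hlt) hmin
  rw [not_or, not_not] at key
  obtain ⟨huc, hvc⟩ := hadj c hcu hcv hc
  obtain ⟨hud, hvd⟩ := hadj d hdu hdv hd
  refine ⟨c, d, hcd, hc, hd, ⟨huc, hvc, key.1.1⟩, ⟨hud, hvd, key.1.2⟩, fun z h1 h2 => ?_⟩
  by_contra! hz
  exact key.2 ⟨z, hz.1, hz.2.1, hz.2.2, h1, h2⟩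

theorem IsInducedThreeCycle.rotate {u v w : V} (h : X.IsInducedThreeCycle u v w) :
    X.IsInducedThreeCycle v w u := by
  refine ⟨h.2.1, h.2.2.1.symm, h.1.symm, fun hf => h.2.2.2 ?_⟩
  have : ({u, v, w} : Finset V) = {v, w, u} := by ext; simp; tauto
  rwa [this]

theorem IsTriangulatedTwoSphere.card_eq_five_of_bipyramid (h : X.IsTriangulatedTwoSphere)
    {u v w c d : V} (huv : u ≠ v) (huw : u ≠ w) (hvw : v ≠ w) (huc : u ≠ c) (hvc : v ≠ c)
    (hwc : w ≠ c) (hud : u ≠ d) (hvd : v ≠ d) (hwd : w ≠ d) (hcd : c ≠ d)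
    (h1 : {u, v, c} ∈ X.faces) (h2 : {u, v, d} ∈ X.faces) (h3 : {v, w, c} ∈ X.faces)
    (h4 : {v, w, d} ∈ X.faces) (h5 : {w, u, c} ∈ X.faces) (h6 : {w, u, d} ∈ X.faces) :
    Fintype.card V = 5 := by
  let T : Set (Finset V) := {{u, v, c}, {u, v, d}, {v, w, c}, {v, w, d}, {w, u, c}, {w, u, d}}
  have hT : T ⊆ X.faces := by
    rintro τ (rfl | rfl | rfl | rfl | rfl | rfl) <;> assumption
  have rot : ∀ x y z : V, ({x, y, z} : Finset V) = {y, z, x} := fun x y z => by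
    ext; simp; tauto
  have swp : ∀ x y z : V, ({x, y, z} : Finset V) = {y, x, z} := fun x y z => by
    ext; simp; tauto
  have t1 : {u, v, c} ∈ T := by simp [T]
  have t2 : {u, v, d} ∈ T := by simp [T]
  have t3 : {v, w, c} ∈ T := by simp [T]
  have t4 : {v, w, d} ∈ T := by simp [T]
  have t5 : {w, u, c} ∈ T := by simp [T]
  have t6 : {w, u, d} ∈ T := by simp [T]
  have E : ∀ p q r s, p ≠ q → p ≠ r → p ≠ s → q ≠ r → q ≠ s → r ≠ s → {p, q, r} ∈ T →
      {p, q, s} ∈ T → ∀ σ ∈ X.faces, p ∈ σ → q ∈ σ → ∃ ρ ∈ T, σ ⊆ ρ := by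
    intro p q r s k1 k2 k3 k4 k5 k6 k7 k8 σ hσ hp hq
    rcases h.subset_triangle k1 k2 k3 k4 k5 k6 (hT k7) (hT k8) hσ hp hq with hh | hh
    · exact ⟨_, k7, hh⟩
    · exact ⟨_, k8, hh⟩
  have e1 := E u v c d huv huc hud hvc hvd hcd t1 t2
  have e2 := E v w c d hvw hvc hvd hwc hwd hcd t3 t4
  have e3 := E w u c d huw.symm hwc hwd huc hud hcd t5 t6
  have s1 : {v, c, u} ∈ T := rot u v c ▸ t1
  have s3 : {w, c, v} ∈ T := rot v w c ▸ t3
  have s5 : {u, c, w} ∈ T := rot w u c ▸ t5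
  have s2 : {v, d, u} ∈ T := rot u v d ▸ t2
  have s4 : {w, d, v} ∈ T := rot v w d ▸ t4
  have s6 : {u, d, w} ∈ T := rot w u d ▸ t6
  have r1 : {u, c, v} ∈ T := by rw [rot, swp]; exact s1
  have r3 : {v, c, w} ∈ T := by rw [rot, swp]; exact s3
  have r5 : {w, c, u} ∈ T := by rw [rot, swp]; exact s5
  have r2 : {u, d, v} ∈ T := by rw [rot, swp]; exact s2
  have r4 : {v, d, w} ∈ T := by rw [rot, swp]; exact s4
  have r6 : {w, d, u} ∈ T := by rw [rot, swp]; exact s6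
  have e4 := E u c v w huc huv huw hvc.symm hwc.symm hvw r1 s5
  have e5 := E v c u w hvc huv.symm hvw huc.symm hwc.symm huw s1 r3
  have e6 := E w c u v hwc huw.symm hvw.symm huc.symm hvc.symm huv r5 s3
  have e7 := E u d v w hud huv huw hvd.symm hwd.symm hvw r2 s6
  have e8 := E v d u w hvd huv.symm hvw hud.symm hwd.symm huw s2 r4
  have e9 := E w d u v hwd huw.symm hvw.symm hud.symm hvd.symm huv r6 s4
  have hcard : ({u, v, w, c, d} : Finset V).card = 5 := by
    rw [Finset.card_insert_of_notMem (by simp [huv, huw, huc, hud]),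
      Finset.card_insert_of_notMem (by simp [hvw, hvc, hvd]),
      Finset.card_insert_of_notMem (by simp [hwc, hwd]), Finset.card_pair hcd]
  rw [← hcard, ← Finset.card_univ]
  congr 1
  symm
  rw [Finset.eq_univ_iff_forall]
  refine h.mem_of_closed_family hT ?_ ⟨_, t1, ?_⟩ ?_
  · rintro τ (rfl | rfl | rfl | rfl | rfl | rfl) <;> (intro x; simp; tauto)
  · rw [Finset.card_insert_of_notMem (by simp [huv, huc]), Finset.card_pair hvc]; norm_num
  · have key : ∀ x y z, (∀ σ ∈ X.faces, x ∈ σ → y ∈ σ → ∃ ρ ∈ T, σ ⊆ ρ) →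
        (∀ σ ∈ X.faces, x ∈ σ → z ∈ σ → ∃ ρ ∈ T, σ ⊆ ρ) →
        (∀ σ ∈ X.faces, y ∈ σ → z ∈ σ → ∃ ρ ∈ T, σ ⊆ ρ) → ∀ σ ∈ X.faces,
        ∀ p ∈ σ, ∀ q ∈ σ, p ≠ q → p ∈ ({x, y, z} : Finset V) → q ∈ ({x, y, z} : Finset V) →
        ∃ ρ ∈ T, σ ⊆ ρ := by
      clear_value T
      intro x y z k1 k2 k3 σ hσ p hp q hq hpq hpt hqt
      simp only [Finset.mem_insert, Finset.mem_singleton] at hpt hqt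
      rcases hpt with rfl | rfl | rfl <;> rcases hqt with rfl | rfl | rfl
      exacts [absurd rfl hpq, k1 σ hσ hp hq, k2 σ hσ hp hq, k1 σ hσ hq hp, absurd rfl hpq,
        k3 σ hσ hp hq, k2 σ hσ hq hp, k3 σ hσ hq hp, absurd rfl hpq]
    rintro σ hσ τ (rfl | rfl | rfl | rfl | rfl | rfl)
    exacts [key u v c e1 e4 e5 σ hσ, key u v d e1 e7 e8 σ hσ, key v w c e2 e5 e6 σ hσ,
      key v w d e2 e8 e9 σ hσ, key w u c e3 e6 e4 σ hσ, key w u d e3 e9 e7 σ hσ]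

theorem IsMinimumTwoSphere.card_eq_five (h : X.IsMinimumTwoSphere) {u v w : V}
    (huvw : X.IsInducedThreeCycle u v w) : Fintype.card V = 5 := by
  have huv := huvw.1
  have hvw := huvw.2.1
  have huw := huvw.2.2.1
  obtain ⟨c, d, hcd, hc, hd, hcadj, hdadj, hnb⟩ := h.adj_apex huvw
  obtain ⟨c₁, d₁, hcd₁, hc₁, hd₁, hcadj₁, hdadj₁, -⟩ := h.adj_apex huvw.rotate
  obtain ⟨c₂, d₂, hcd₂, hc₂, hd₂, hcadj₂, hdadj₂, -⟩ := h.adj_apex huvw.rotate.rotate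
  have key : ∀ x y c' d', {x, y, c'} ∈ X.faces → {x, y, d'} ∈ X.faces → c' ≠ d' →
      (c' = c ∨ c' = d) → (d' = c ∨ d' = d) → {x, y, c} ∈ X.faces ∧ {x, y, d} ∈ X.faces := by
    rintro x y c' d' k1 k2 k3 (rfl | rfl) (rfl | rfl)
    exacts [absurd rfl k3, ⟨k1, k2⟩, ⟨k2, k1⟩, absurd rfl k3]
  obtain ⟨k1, k2⟩ := key v w c₁ d₁ hc₁ hd₁ hcd₁
    ((hnb c₁ hcadj₁.2.2 hcadj₁.1).resolve_left hcadj₁.2.1.ne')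
    ((hnb d₁ hdadj₁.2.2 hdadj₁.1).resolve_left hdadj₁.2.1.ne')
  obtain ⟨k3, k4⟩ := key w u c₂ d₂ hc₂ hd₂ hcd₂
    ((hnb c₂ hcadj₂.2.1 hcadj₂.2.2).resolve_left hcadj₂.1.ne')
    ((hnb d₂ hdadj₂.2.1 hdadj₂.2.2).resolve_left hdadj₂.1.ne')
  exact h.1.card_eq_five_of_bipyramid huv.ne huw.ne hvw.ne hcadj.1.ne hcadj.2.1.ne hcadj.2.2.ne
    hdadj.1.ne hdadj.2.1.ne hdadj.2.2.ne hcd hc hd k1 k2 k3 k4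

theorem exists_isTriangulatedTwoSphere (hV : 4 ≤ Fintype.card V) :
    ∃ X : AbstractSimplicialComplex V, X.IsTriangulatedTwoSphere := by
  obtain ⟨F, hF, hFv, _, hhom⟩ :=
    exists_faceUnion_homeomorph_sphere (Finset.univ : Finset V) (by simpa using hV)
  exact ⟨{ faces := F
           isRelLowerSet_faces := fun {σ} hσ =>
            ⟨(hF σ hσ).1, fun τ hτ hne => (hF σ hσ).2.2 τ hτ hne⟩
           singleton_mem := fun v => hFv v (Finset.mem_univ v) }, hhom⟩

theorem exists_isMinimumTwoSphere (hV : 4 ≤ Fintype.card V) :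
    ∃ X : AbstractSimplicialComplex V, X.IsMinimumTwoSphere := by
  have hinj : Function.Injective fun X : AbstractSimplicialComplex V => X.faces := by
    rintro ⟨⟨F, _⟩, _⟩ ⟨⟨F', _⟩, _⟩ hFF'
    simp only at hFF'
    subst hFF'
    rfl
  have := Finite.of_injective _ hinj
  obtain ⟨X, hX, hmin⟩ := Set.exists_min_image
    {X : AbstractSimplicialComplex V | X.IsTriangulatedTwoSphere} separationIndex (Set.toFinite _)
    (exists_isTriangulatedTwoSphere hV)
  exact ⟨X, hX, hmin⟩

end AbstractSimplicialComplex

end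

theorem theorem2 (n : ℕ) (hn : n ≠ 5) {V : Type*} [Fintype V] [DecidableEq V]
    (hV : Fintype.card V = n) :
    (4 ≤ n → ∃ X : AbstractSimplicialComplex V, X.IsMinimumTwoSphere ∧ X.IsFlagTwoSphere) ∧
      ∀ X : AbstractSimplicialComplex V, X.IsMinimumTwoSphere → X.IsFlagTwoSphere := by
  have hflag : ∀ X : AbstractSimplicialComplex V, X.IsMinimumTwoSphere → X.IsFlagTwoSphere :=
    fun X hX => ⟨hX.1, fun u v w huvw => hn (hV ▸ hX.card_eq_five huvw)⟩
  refine ⟨fun h4 => ?_, hflag⟩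
  obtain ⟨X, hX⟩ := AbstractSimplicialComplex.exists_isMinimumTwoSphere (V := V) (hV ▸ h4)
  exact ⟨X, hX, hflag X hX⟩
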